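/- Let $1<n<N$ be integers and let $B\subset\mathbb{R}^{N}$ be a convex body (a compact convex set with nonempty interior). Suppose that the orthogonal projections of $B$ onto the $n$-dimensional linear subspaces of $\mathbb{R}^{N}$ are pairwise affinely equivalent, that is, for any two $n$-dimensional linear subspaces $U,W\subset\mathbb{R}^N$ there is an affine isomorphism $U\to W$ mapping the orthogonal projection of $B$ onto $U$ onto the orthogonal projection of $B$ onto $W$. Then $B$ is centrally symmetric: there is a point $c\in\mathbb{R}^{N}$ such that $2c-B=B$. -/

import Mathlib

/-- Two sets, each a subset of a real vector space, are affinely equivalent if an affine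
isomorphism between their ambient vector spaces maps one onto the other. -/
def AffinelyEquivalent {V W : Type*} [AddCommGroup V] [Module ℝ V] [AddCommGroup W] [Module ℝ W]
    (S : Set V) (T : Set W) : Prop :=
  ∃ f : V ≃ᵃ[ℝ] W, f '' S = T

/-- The orthogonal projection of a set `S` onto a linear subspace `U`, as a subset of `U`. -/
def orthProj {N : ℕ} (U : Submodule ℝ (EuclideanSpace ℝ (Fin N)))
    (S : Set (EuclideanSpace ℝ (Fin N))) : Set U :=
  U.orthogonalProjectionOnto '' S

/-- A set is centrally symmetric if it is invariant under the reflection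
`x ↦ 2 c - x` in some point `c`. -/
def CentrallySymmetric {V : Type*} [AddCommGroup V] [Module ℝ V] (S : Set V) : Prop :=
  ∃ c : V, AffineEquiv.pointReflection ℝ c '' S = S

/-! The projection of `B` onto a subspace has as support function the restriction of the support
function of `B`, and affine equivalence of two projections means that one restriction pulls back to
the other along a linear map, up to a linear functional. Let `k` be the restriction to an
`n`-dimensional space `Y`, and `h` the restriction to an `(n + 1)`-dimensional space `E`. Then every
hyperplane `uᗮ` of `E` carries copies of `k`, the set `positionsAt h k u`, and these form one orbit
of the compact symmetry group `positions k k`.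

The heart is that every `e ≠ 0` in `Y` is sent to `-e` by some symmetry
(`exists_positions_apply_eq_neg`). The map `q = equatorPush` folds the sphere into the closed upper
half-space without the origin. That set is star-shaped about the pole, so positions `L x` in the
hyperplanes `(q x)ᗮ` can be chosen continuously (`exists_continuous_positionsAt`). Near the equator
`q` is odd, so `L x` and `L (-x)` lie in the same hyperplane and differ by a symmetry `g`. Cutoffs
glue `L x e` and `L (-x) e` to an even map `b`. An even map has even degree, so the segment from `x`
to `b x` must meet `0` for some `x` (`exists_segment_eq_zero_of_even`). Orthogonality to `q` then
forces `b x = 0` close to the equator, and invariance of the width turns this cancellation into `g e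
= -e`. The degree argument is a mod 2 count of alternating labels in the style of Ky Fan.

Subtract from the odd part of `k` its `L²` projection to the linear functionals. The rest is
invariant under all symmetries, hence takes equal values at `e` and `-e`; being odd, it vanishes
(`exists_linear_eq_odd_part`). Since `n ≥ 2`, any two vectors share an `n`-dimensional subspace, so
the odd part of the support function of `B` is linear on the whole space, and half of the vector
representing it is the centre. -/

/-! ### Mod 2 cochains on ordered simplices -/

/-- The shuffle product of a mod 2 cochain on ordered simplices with a `0`-cochain `f`. -/
def wedge {V : Type*} (f : V → ZMod 2) : (List V → ZMod 2) → List V → ZMod 2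
  | _, [] => 0
  | A, a :: l => f a * A l + wedge f (fun l' => A (a :: l')) l

/-- The mod 2 simplicial coboundary. -/
def coboundary {V : Type*} (A : List V → ZMod 2) : List V → ZMod 2 := wedge (fun _ => 1) A

/-- The dual of the prism operator between two maps of vertices. -/
def prism {V W : Type*} (φ ψ : V → W) : (List W → ZMod 2) → List V → ZMod 2
  | _, [] => 0
  | A, a :: l => A (φ a :: ψ a :: l.map ψ) + prism φ ψ (fun l' => A (φ a :: l')) l

section Wedge

variable {V W : Type*}

theorem zmod_two_add_self (a : ZMod 2) : a + a = 0 := CharTwo.add_self_eq_zero a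

theorem wedge_congr (f : V → ZMod 2) {A A' : List V → ZMod 2} {l : List V}
    (h : ∀ l', l' ⊆ l → A l' = A' l') : wedge f A l = wedge f A' l := by
  induction l generalizing A A' with
  | nil => rfl
  | cons a l ih =>
    simp only [wedge]
    rw [h l (List.subset_cons_self a l), ih (fun l' hl' => h _ (List.cons_subset_cons a hl'))]

theorem wedge_add_right (f : V → ZMod 2) (A A' : List V → ZMod 2) (l : List V) :
    wedge f (fun l => A l + A' l) l = wedge f A l + wedge f A' l := by
  induction l generalizing A A' with
  | nil => simp [wedge]
  | cons a l ih => simp only [wedge, ih]; ring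

theorem wedge_mul_right (f : V → ZMod 2) (c : ZMod 2) (A : List V → ZMod 2) (l : List V) :
    wedge f (fun l => c * A l) l = c * wedge f A l := by
  induction l generalizing A with
  | nil => simp [wedge]
  | cons a l ih => simp only [wedge, ih]; ring

theorem wedge_add_left (f g : V → ZMod 2) (A : List V → ZMod 2) (l : List V) :
    wedge (fun v => f v + g v) A l = wedge f A l + wedge g A l := by
  induction l generalizing A with
  | nil => simp [wedge]
  | cons a l ih => simp only [wedge, ih]; ring

theorem wedge_eq_zero_of_left {f : V → ZMod 2} {l : List V} (A : List V → ZMod 2)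
    (h : ∀ v ∈ l, f v = 0) : wedge f A l = 0 := by
  induction l generalizing A with
  | nil => rfl
  | cons a l ih =>
    simp only [wedge]
    rw [h a (by simp), ih _ (fun v hv => h v (by simp [hv]))]
    simp

theorem wedge_eq_zero_of_right (f : V → ZMod 2) {A : List V → ZMod 2} {l : List V}
    (h : ∀ l', l' ⊆ l → A l' = 0) : wedge f A l = 0 := by
  induction l generalizing A with
  | nil => rfl
  | cons a l ih =>
    simp only [wedge]
    rw [h l (List.subset_cons_self a l), ih (fun l' hl' => h _ (List.cons_subset_cons a hl'))]
    simp

/-- `wedge f A l` sums `f v * A (l without v)` over the positions of `l`, so both sides are a sum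
over ordered pairs of deleted positions. -/
theorem wedge_comm (f g : V → ZMod 2) (A : List V → ZMod 2) (l : List V) :
    wedge f (wedge g A) l = wedge g (wedge f A) l := by
  induction l generalizing A with
  | nil => rfl
  | cons a l ih =>
    simp only [wedge, wedge_add_right, wedge_mul_right]
    rw [show (wedge f (fun l' => wedge g (fun l' => A (a :: l')) l') l) =
      wedge g (fun l' => wedge f (fun l' => A (a :: l')) l') l from ih _]
    ring

theorem wedge_wedge_eq_zero {f g : V → ZMod 2} {l : List V} (A : List V → ZMod 2)
    (h : ∀ a ∈ l, ∀ b ∈ l, f a * g b = 0) : wedge f (wedge g A) l = 0 := by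
  induction l generalizing A with
  | nil => rfl
  | cons a l ih =>
    simp only [wedge, wedge_add_right, wedge_mul_right]
    have h1 : f a * wedge g A l = 0 := by
      by_cases hf : f a = 0
      · simp [hf]
      · rw [wedge_eq_zero_of_left A fun v hv => ?_, mul_zero]
        exact (mul_eq_zero.1 (h a (by simp) v (by simp [hv]))).resolve_left hf
    have h2 : g a * wedge f A l = 0 := by
      by_cases hg : g a = 0
      · simp [hg]
      · rw [wedge_eq_zero_of_left A fun v hv => ?_, mul_zero]
        exact (mul_eq_zero.1 (h v (by simp [hv]) a (by simp))).resolve_right hg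
    have h3 := ih (fun l' => A (a :: l')) (fun x hx y hy => h x (by simp [hx]) y (by simp [hy]))
    rw [h1, h2]
    simpa using h3

/-- Each unordered pair of deleted positions occurs twice. -/
theorem wedge_self (f : V → ZMod 2) (A : List V → ZMod 2) (l : List V) :
    wedge f (wedge f A) l = 0 := by
  induction l generalizing A with
  | nil => rfl
  | cons a l ih =>
    simp only [wedge, wedge_add_right, wedge_mul_right]
    rw [show wedge f (fun l' => wedge f (fun l' => A (a :: l')) l') l = 0 from ih _, add_zero,
      zmod_two_add_self]

theorem wedge_map (f : W → ZMod 2) (φ : V → W) (A : List W → ZMod 2) (l : List V) :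
    wedge f A (l.map φ) = wedge (fun v => f (φ v)) (fun l => A (l.map φ)) l := by
  induction l generalizing A with
  | nil => rfl
  | cons a l ih => simp only [wedge, List.map_cons, ih]

theorem prism_add (φ ψ : V → W) (A A' : List W → ZMod 2) (l : List V) :
    prism φ ψ (fun l => A l + A' l) l = prism φ ψ A l + prism φ ψ A' l := by
  induction l generalizing A A' with
  | nil => simp [prism]
  | cons a l ih => simp only [prism, ih]; ring

theorem prism_eq_zero {φ ψ : V → W} {A : List W → ZMod 2} {l : List V}
    (h : ∀ l' : List W, l'.length = l.length + 1 →
      (∀ x ∈ l', ∃ v ∈ l, x = φ v ∨ x = ψ v) → A l' = 0) :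
    prism φ ψ A l = 0 := by
  induction l generalizing A with
  | nil => rfl
  | cons a l ih =>
    simp only [prism]
    rw [h, ih, add_zero]
    · intro l' hl' hx
      refine h _ (by simp [hl']) fun x hx' => ?_
      rcases List.mem_cons.1 hx' with rfl | hx'
      · exact ⟨a, by simp, Or.inl rfl⟩
      · obtain ⟨v, hv, hv'⟩ := hx x hx'
        exact ⟨v, by simp [hv], hv'⟩
    · simp
    · intro x hx
      simp only [List.mem_cons, List.mem_map] at hx
      rcases hx with rfl | rfl | ⟨v, hv, rfl⟩
      · exact ⟨a, by simp, Or.inl rfl⟩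
      · exact ⟨a, by simp, Or.inr rfl⟩
      · exact ⟨v, by simp [hv], Or.inr rfl⟩

/-- The chain homotopy identity: interior faces of the prism cancel in pairs, the side faces give
the coboundary of the prism, and its two ends remain. -/
theorem prism_coboundary (φ ψ : V → W) (A : List W → ZMod 2) (l : List V) :
    prism φ ψ (coboundary A) l =
      coboundary (prism φ ψ A) l + (A (l.map φ) + A (l.map ψ)) := by
  induction l generalizing A with
  | nil => simp [prism, coboundary, wedge, zmod_two_add_self]
  | cons a l ih =>
    have ih' := ih (fun l' => A (φ a :: l'))
    simp only [coboundary] at ih' ⊢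
    simp only [prism, wedge, wedge_add_right, List.map_cons, one_mul, prism_add, wedge_map] at ih' ⊢
    rw [ih']
    generalize wedge (fun x => (1 : ZMod 2)) (fun l_1 => A (φ a :: ψ a :: List.map ψ l_1)) l = x1
    generalize wedge (fun _ => (1 : ZMod 2)) (prism φ ψ fun l' => A (φ a :: l')) l = x2
    have h2 : (2 : ZMod 2) = 0 := rfl
    linear_combination (A (φ a :: List.map ψ l)) * h2

end Wedge

/-! ### Ky Fan's count of alternating simplices -/

/-- The sign at position `k` of the alternating sequence of signs that starts with `s`. -/
def alternatingSign (s : Bool) (k : ℕ) : Bool := not^[k] s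

/-- The `0`-cochain that detects one label. -/
def labelIndicator (p : ℕ × Bool) (v : ℕ × Bool) : ZMod 2 := if v = p then 1 else 0

/-- The cochain which is `1` on simplices with `k` vertices whose labels have indices below `N` and,
ordered by index, signs alternating from `s` on. -/
def alternating (s : Bool) : ℕ → ℕ → List (ℕ × Bool) → ZMod 2
  | _, 0 => fun l => if l = [] then 1 else 0
  | 0, _ + 1 => fun _ => 0
  | N + 1, k + 1 => fun l => alternating s N (k + 1) l +
      wedge (labelIndicator (N, alternatingSign s k)) (alternating s N k) l

/-- No two vertices carry opposite labels. -/
def NoComplementary (l : List (ℕ × Bool)) : Prop := ∀ i, (i, true) ∈ l → (i, false) ∉ l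

theorem NoComplementary.mono {l l' : List (ℕ × Bool)} (h : NoComplementary l) (hl : l' ⊆ l) :
    NoComplementary l' := fun i h1 h2 => h i (hl h1) (hl h2)

theorem alternatingSign_succ (s : Bool) (k : ℕ) :
    alternatingSign s (k + 1) = !alternatingSign s k := by
  simp [alternatingSign, Function.iterate_succ_apply']

theorem alternatingSign_not (s : Bool) (k : ℕ) :
    alternatingSign (!s) k = !alternatingSign s k := by
  rw [← alternatingSign_succ]; simp [alternatingSign]

theorem alternating_zero (s : Bool) (N : ℕ) (l : List (ℕ × Bool)) :
    alternating s N 0 l = if l = [] then 1 else 0 := by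
  cases N <;> rfl

/-- The indices counted are distinct and below `N`, so there are at most `N` vertices. -/
theorem alternating_eq_zero (s : Bool) {N k : ℕ} (h : N < k) (l : List (ℕ × Bool)) :
    alternating s N k l = 0 := by
  induction N generalizing k l with
  | zero =>
    obtain ⟨k, rfl⟩ := Nat.exists_eq_succ_of_ne_zero (by omega : k ≠ 0)
    rfl
  | succ N ih =>
    obtain ⟨k, rfl⟩ := Nat.exists_eq_succ_of_ne_zero (by omega : k ≠ 0)
    simp only [alternating]
    rw [ih (by omega), wedge_eq_zero_of_right _ fun l' _ => ih (by omega) l', add_zero]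

theorem alternating_map_flip (s : Bool) (N k : ℕ) (l : List (ℕ × Bool)) :
    alternating s N k (l.map fun p => (p.1, !p.2)) = alternating (!s) N k l := by
  induction N generalizing k l with
  | zero => cases k <;> simp [alternating]
  | succ N ih =>
    cases k with
    | zero => simp [alternating]
    | succ k =>
      simp only [alternating, wedge_map, ih]
      congr 2
      funext v
      obtain ⟨i, b⟩ := v
      simp only [labelIndicator, alternatingSign_not, Prod.mk.injEq]
      congr 1
      cases b <;> cases alternatingSign s k <;> simp

/-- The parity count behind Ky Fan's lemma. The weight `p.1 < N` allows induction on `N`: passing to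
`N + 1` adds just the two labels of index `N`, which `hs` splits off. -/
theorem wedge_alternating (s : Bool) (N k : ℕ) {l : List (ℕ × Bool)} (hl : NoComplementary l) :
    wedge (fun p => if p.1 < N then 1 else 0) (alternating s N k) l =
      alternating s N (k + 1) l + alternating (!s) N (k + 1) l := by
  induction N generalizing k l with
  | zero =>
    rw [wedge_eq_zero_of_left _ (by simp)]
    simp [alternating]
  | succ N ih =>
    have hs : (fun p : ℕ × Bool => if p.1 < N + 1 then (1 : ZMod 2) else 0) =
        fun p => (if p.1 < N then 1 else 0) +
          (labelIndicator (N, alternatingSign s k) p +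
            labelIndicator (N, !alternatingSign s k) p) := by
      funext ⟨i, b⟩
      simp only [labelIndicator, Prod.mk.injEq]
      rcases lt_trichotomy i N with h | h | h
      · simp [h, h.ne, h.trans (Nat.lt_succ_self N)]
      · subst h
        cases b <;> cases alternatingSign s k <;> simp
      · simp [h.ne', not_lt.2 h.le, not_lt.2 (Nat.succ_le_of_lt h)]
    have key : wedge (fun p : ℕ × Bool => if p.1 < N + 1 then (1 : ZMod 2) else 0)
        (alternating s N k) l = alternating s N (k + 1) l + alternating (!s) N (k + 1) l +
          (wedge (labelIndicator (N, alternatingSign s k)) (alternating s N k) l +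
            wedge (labelIndicator (N, !alternatingSign s k)) (alternating s N k) l) := by
      rw [hs, wedge_add_left, wedge_add_left, ih k hl]
    cases k with
    | zero =>
      have h0 : alternating s (N + 1) 0 = alternating s N 0 := by
        funext l; simp [alternating_zero]
      have h1 : alternating (!s) N 0 = alternating s N 0 := by
        funext l; simp [alternating_zero]
      rw [h0, key]
      simp only [alternating, alternatingSign_not, h1]
      ring
    | succ k =>
      have hd : ∀ f : ℕ × Bool → ZMod 2, wedge f (alternating s (N + 1) (k + 1)) l =
          wedge f (alternating s N (k + 1)) l + wedge f
            (wedge (labelIndicator (N, alternatingSign s k)) (alternating s N k)) l := by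
        intro f
        rw [← wedge_add_right]
        rfl
      have hz : wedge (fun p : ℕ × Bool => if p.1 < N + 1 then (1 : ZMod 2) else 0)
          (wedge (labelIndicator (N, alternatingSign s k)) (alternating s N k)) l =
          wedge (labelIndicator (N, alternatingSign s k)) (alternating s N (k + 1)) l +
          wedge (labelIndicator (N, alternatingSign s k)) (alternating (!s) N (k + 1)) l := by
        rw [hs, wedge_add_left, wedge_add_left, wedge_comm, ← wedge_add_right,
          wedge_congr _ fun l' hl' => ih k (hl.mono hl')]
        -- Two labels of index `N` with different signs are complementary and cannot both occur;
        -- pairs with equal signs are removed by `wedge_self`.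
        have h1 : wedge (labelIndicator (N, alternatingSign s (k + 1)))
            (wedge (labelIndicator (N, alternatingSign s k)) (alternating s N k)) l = 0 := by
          refine wedge_wedge_eq_zero _ ?_
          intro a ha b hb
          simp only [labelIndicator, alternatingSign_succ]
          split_ifs with h1 h2 <;> try simp
          subst h1 h2
          cases h : alternatingSign s k <;> simp only [h, Bool.not_false, Bool.not_true] at ha hb
          · exact hl N ha hb
          · exact hl N hb ha
        rw [h1, alternatingSign_succ, Bool.not_not, wedge_self]
        simp
      rw [hd, key, hz]
      simp only [alternating, alternatingSign_succ, alternatingSign_not, Bool.not_not]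
      have h2 : (2 : ZMod 2) = 0 := rfl
      linear_combination (wedge (labelIndicator (N, alternatingSign s k)) (alternating s N (k + 1)) l) * h2

theorem coboundary_alternating (s : Bool) (N k : ℕ) {l : List (ℕ × Bool)} (hl : NoComplementary l)
    (hN : ∀ p ∈ l, p.1 < N) :
    coboundary (alternating s N k) l =
      alternating s N (k + 1) l + alternating (!s) N (k + 1) l := by
  rw [← wedge_alternating s N k hl, coboundary]
  have h : wedge (fun p : ℕ × Bool => (1 : ZMod 2) + if p.1 < N then 1 else 0)
      (alternating s N k) l = 0 :=
    wedge_eq_zero_of_left _ fun p hp => by simp [hN p hp, zmod_two_add_self]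
  rw [wedge_add_left] at h
  exact CharTwo.add_eq_zero.1 h

/-! ### Subdivided hemispheres and Stokes' formula -/

section Hemisphere

theorem coboundary_map {V W : Type*} (φ : V → W) (A : List W → ZMod 2) (l : List V) :
    coboundary A (l.map φ) = coboundary (fun l => A (l.map φ)) l :=
  wedge_map _ _ _ _

variable {V : Type*} [AddCommGroup V] [Module ℝ V]

/-- The `j`-th of `m` steps from `x` to `p` along a segment. -/
noncomputable def coneStep (m : ℕ) (p : V) (j : ℕ) (x : V) : V :=
  (1 - (j / m : ℝ)) • x + (j / m : ℝ) • p

/-- Evaluation of cochains on a subdivided `k`-dimensional hemisphere with vertices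
`± e 0, …, ± e (k - 1), e k`, built by coning off its boundary sphere in `m` steps. -/
noncomputable def hemisphere (e : ℕ → V) (m : ℕ) : ℕ → (List V → ZMod 2) → ZMod 2
  | 0, A => A [e 0]
  | k + 1, A => ∑ j ∈ Finset.range m,
      (hemisphere e m k (prism (coneStep m (e (k + 1)) j) (coneStep m (e (k + 1)) (j + 1)) A) +
        hemisphere e m k fun l =>
          prism (coneStep m (e (k + 1)) j) (coneStep m (e (k + 1)) (j + 1)) A
            (l.map fun x => -x))

/-- Evaluation of cochains on the sphere that consists of a hemisphere and its antipode. -/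
noncomputable def sphereSum (e : ℕ → V) (m k : ℕ) (A : List V → ZMod 2) : ZMod 2 :=
  hemisphere e m k A + hemisphere e m k fun l => A (l.map fun x => -x)

variable (e : ℕ → V) (m : ℕ)

theorem hemisphere_succ (k : ℕ) (A : List V → ZMod 2) :
    hemisphere e m (k + 1) A = ∑ j ∈ Finset.range m, sphereSum e m k
      (prism (coneStep m (e (k + 1)) j) (coneStep m (e (k + 1)) (j + 1)) A) := rfl

theorem hemisphere_add (k : ℕ) (A A' : List V → ZMod 2) :
    hemisphere e m k (fun l => A l + A' l) = hemisphere e m k A + hemisphere e m k A' := by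
  induction k generalizing A A' with
  | zero => rfl
  | succ k ih =>
    simp only [hemisphere, ← Finset.sum_add_distrib]
    refine Finset.sum_congr rfl fun j _ => ?_
    have h : ∀ φ ψ : V → V, prism φ ψ (fun l => A l + A' l) =
        fun l => prism φ ψ A l + prism φ ψ A' l := fun φ ψ => funext (prism_add φ ψ A A')
    rw [h, ih, ih]
    ring

theorem sphereSum_add (k : ℕ) (A A' : List V → ZMod 2) :
    sphereSum e m k (fun l => A l + A' l) = sphereSum e m k A + sphereSum e m k A' := by
  simp only [sphereSum, hemisphere_add]
  ring

theorem sphereSum_eq_zero_of_even (k : ℕ) {A : List V → ZMod 2}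
    (h : ∀ l, A (l.map fun x => -x) = A l) : sphereSum e m k A = 0 := by
  simp only [sphereSum, h]
  exact zmod_two_add_self _

theorem coneStep_zero (p : V) : coneStep m p 0 = id := by
  funext x; simp [coneStep]

theorem coneStep_self (hm : m ≠ 0) (p x : V) : coneStep m p m x = p := by
  simp [coneStep, hm]

theorem sum_range_add_succ_zmod_two (f : ℕ → ZMod 2) (m : ℕ) :
    ∑ j ∈ Finset.range m, (f j + f (j + 1)) = f 0 + f m := by
  induction m with
  | zero => simp [zmod_two_add_self]
  | succ m ih =>
    rw [Finset.sum_range_succ, ih]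
    have h2 : (2 : ZMod 2) = 0 := rfl
    linear_combination f m * h2

/-- The prism identity makes the layers telescope. The layer `j = 0` is the boundary sphere; at `j =
m` everything has collapsed to the apex, where antipodal contributions cancel. -/
theorem hemisphere_coboundary_of_sphereSum (hm : m ≠ 0) (k : ℕ)
    (h : ∀ A : List V → ZMod 2, sphereSum e m k (coboundary A) = 0) (A : List V → ZMod 2) :
    hemisphere e m (k + 1) (coboundary A) = sphereSum e m k A := by
  have h1 : ∀ φ ψ : V → V, sphereSum e m k (prism φ ψ (coboundary A)) =
      sphereSum e m k (fun l => A (l.map φ)) + sphereSum e m k (fun l => A (l.map ψ)) := by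
    intro φ ψ
    rw [show prism φ ψ (coboundary A) = fun l => coboundary (prism φ ψ A) l +
        (A (l.map φ) + A (l.map ψ)) from funext (prism_coboundary φ ψ A),
      sphereSum_add, h, zero_add, sphereSum_add]
  simp only [hemisphere_succ, h1]
  rw [sum_range_add_succ_zmod_two
    (fun j => sphereSum e m k fun l => A (l.map (coneStep m (e (k + 1)) j)))]
  have h2 : sphereSum e m k (fun l => A (l.map (coneStep m (e (k + 1)) m))) = 0 := by
    refine sphereSum_eq_zero_of_even e m k fun l => ?_
    simp [funext (coneStep_self m hm (e (k + 1))), Function.comp_def]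
  rw [h2, add_zero, coneStep_zero]
  simp

/-- The two hemispheres have the same boundary sphere, which is counted twice. -/
theorem sphereSum_coboundary (hm : m ≠ 0) (k : ℕ) (A : List V → ZMod 2) :
    sphereSum e m k (coboundary A) = 0 := by
  induction k generalizing A with
  | zero => simp [sphereSum, hemisphere, coboundary, wedge, zmod_two_add_self]
  | succ k ih =>
    have h := hemisphere_coboundary_of_sphereSum e m hm k ih
    rw [sphereSum, h]
    simp only [coboundary_map]
    rw [show (fun l => coboundary (fun l => A (l.map fun x => -x)) l) =
      coboundary (fun l => A (l.map fun x => -x)) from rfl, h]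
    simp only [sphereSum, List.map_map, Function.comp_def, neg_neg, List.map_id']
    rw [add_comm (hemisphere e m k fun l => A (l.map fun x => -x)), zmod_two_add_self]

theorem hemisphere_coboundary (hm : m ≠ 0) (k : ℕ) (A : List V → ZMod 2) :
    hemisphere e m (k + 1) (coboundary A) = sphereSum e m k A :=
  hemisphere_coboundary_of_sphereSum e m hm k (sphereSum_coboundary e m hm k) A

end Hemisphere

/-! ### Simplices of small diameter on the `ℓ¹` sphere -/

section L1Sphere

variable {n : ℕ}

/-- The unit sphere of the `ℓ¹` norm. -/
def l1Sphere (n : ℕ) : Set (EuclideanSpace ℝ (Fin (n + 1))) := {x | ∑ i, |x i| = 1}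

/-- The standard basis vectors, continued by zero. -/
noncomputable def basisSeq (n : ℕ) (k : ℕ) : EuclideanSpace ℝ (Fin (n + 1)) :=
  if h : k < n + 1 then EuclideanSpace.single ⟨k, h⟩ 1 else 0

theorem norm_le_one_of_mem_l1Sphere {x : EuclideanSpace ℝ (Fin (n + 1))} (hx : x ∈ l1Sphere n) :
    ‖x‖ ≤ 1 := by
  have h : x = ∑ i, EuclideanSpace.single i (x i) := by
    ext j
    simp [Finset.sum_apply]
  calc ‖x‖ = ‖∑ i, EuclideanSpace.single i (x i)‖ := by rw [← h]
    _ ≤ ∑ i, ‖EuclideanSpace.single i (x i)‖ := norm_sum_le _ _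
    _ = 1 := by
      rw [← show ∑ i, |x i| = 1 from hx]
      simp

theorem neg_mem_l1Sphere {x : EuclideanSpace ℝ (Fin (n + 1))} (hx : x ∈ l1Sphere n) :
    -x ∈ l1Sphere n := by
  simpa [l1Sphere] using hx

theorem isCompact_l1Sphere (n : ℕ) : IsCompact (l1Sphere n) := by
  refine Metric.isCompact_of_isClosed_isBounded ?_ ?_
  · exact isClosed_eq (by fun_prop) continuous_const
  · exact (Metric.isBounded_iff_subset_closedBall 0).2
      ⟨1, fun x hx => by simpa using norm_le_one_of_mem_l1Sphere hx⟩

theorem basisSeq_mem {k : ℕ} (hk : k < n + 1) : basisSeq n k ∈ l1Sphere n := by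
  simp [basisSeq, hk, l1Sphere, PiLp.single_apply, apply_ite abs]

theorem basisSeq_apply_of_ne {k : ℕ} {i : Fin (n + 1)} (h : (i : ℕ) ≠ k) : basisSeq n k i = 0 := by
  unfold basisSeq
  split_ifs with hk
  · rw [PiLp.single_apply, if_neg]
    rintro rfl
    exact h rfl
  · rfl

/-- The supports of `x` and of the apex are disjoint, so the `ℓ¹` norm is affine along the segment.
This is why the `ℓ¹` sphere is used: coning needs no normalization. -/
theorem coneStep_mem {k m j : ℕ} (hk : k + 1 < n + 1) (hj : j ≤ m)
    {x : EuclideanSpace ℝ (Fin (n + 1))} (hx : x ∈ l1Sphere n)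
    (hxk : ∀ i : Fin (n + 1), k < i → x i = 0) :
    coneStep m (basisSeq n (k + 1)) j x ∈ l1Sphere n := by
  have h0 : (0 : ℝ) ≤ j / m := by positivity
  have h1 : (j / m : ℝ) ≤ 1 := div_le_one_of_le₀ (by exact_mod_cast hj) (by positivity)
  have h2 := basisSeq_mem hk
  simp only [l1Sphere, Set.mem_ofPred_eq] at hx h2 ⊢
  have h3 : ∀ i, |coneStep m (basisSeq n (k + 1)) j x i| =
      (1 - (j / m : ℝ)) * |x i| + (j / m : ℝ) * |basisSeq n (k + 1) i| := by
    intro i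
    simp only [coneStep, PiLp.add_apply, PiLp.smul_apply, smul_eq_mul]
    rcases le_or_gt (i : ℕ) k with h | h
    · rw [basisSeq_apply_of_ne (by omega)]
      simp [abs_mul, abs_of_nonneg (sub_nonneg.2 h1)]
    · rw [hxk i h]
      simp [abs_mul, abs_of_nonneg h0]
  simp only [h3, Finset.sum_add_distrib, ← Finset.mul_sum, hx, h2]
  ring

theorem coneStep_apply_of_lt {k m j : ℕ}
    {x : EuclideanSpace ℝ (Fin (n + 1))} (hxk : ∀ i : Fin (n + 1), k < i → x i = 0)
    (i : Fin (n + 1)) (hi : k + 1 < i) : coneStep m (basisSeq n (k + 1)) j x i = 0 := by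
  simp [coneStep, basisSeq_apply_of_ne (show (i : ℕ) ≠ k + 1 by omega), hxk i (by omega)]

theorem norm_coneStep_sub_le {m j : ℕ} (hj : j ≤ m) {E : Type*} [NormedAddCommGroup E]
    [NormedSpace ℝ E] (p x y : E) : ‖coneStep m p j x - coneStep m p j y‖ ≤ ‖x - y‖ := by
  have h0 : (0 : ℝ) ≤ j / m := by positivity
  have h1 : (j / m : ℝ) ≤ 1 := div_le_one_of_le₀ (by exact_mod_cast hj) (by positivity)
  have : coneStep m p j x - coneStep m p j y = (1 - (j / m : ℝ)) • (x - y) := by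
    simp only [coneStep]; module
  rw [this, norm_smul, Real.norm_of_nonneg (by linarith)]
  nlinarith [norm_nonneg (x - y)]

theorem norm_coneStep_sub_succ_le {m j : ℕ} {E : Type*} [NormedAddCommGroup E]
    [NormedSpace ℝ E] {p x : E} (hp : ‖p‖ ≤ 1) (hx : ‖x‖ ≤ 1) :
    ‖coneStep m p j x - coneStep m p (j + 1) x‖ ≤ 2 / m := by
  have : coneStep m p j x - coneStep m p (j + 1) x = (1 / m : ℝ) • (x - p) := by
    simp only [coneStep, Nat.cast_add, Nat.cast_one]; module
  rw [this, norm_smul, Real.norm_of_nonneg (by positivity)]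
  have := norm_sub_le x p
  calc (1 / m : ℝ) * ‖x - p‖ ≤ 1 / m * 2 := by gcongr; linarith
    _ = 2 / m := by ring

/-- Lists of points of the `k`-dimensional `ℓ¹` sphere at mutual distance at most `d`. -/
def SmallSimplex (n k : ℕ) (d : ℝ) (l : List (EuclideanSpace ℝ (Fin (n + 1)))) : Prop :=
  (∀ x ∈ l, x ∈ l1Sphere n ∧ ∀ i : Fin (n + 1), k < i → x i = 0) ∧ ∀ x ∈ l, ∀ y ∈ l, ‖x - y‖ ≤ d

/-- Each cone step contracts distances, and consecutive steps of a point differ by at most `2 / m`;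
so each dimension adds at most `2 / m` to the diameter of the simplices. -/
theorem hemisphere_eq_zero {m k : ℕ} (hk : k < n + 1)
    {A : List (EuclideanSpace ℝ (Fin (n + 1))) → ZMod 2}
    (h : ∀ l, SmallSimplex n k (k * (2 / m)) l → A l = 0) :
    hemisphere (basisSeq n) m k A = 0 := by
  induction k generalizing A with
  | zero =>
    refine h _ ⟨fun x hx => ?_, ?_⟩
    · obtain rfl := List.mem_singleton.1 hx
      exact ⟨basisSeq_mem hk, fun i hi => basisSeq_apply_of_ne hi.ne'⟩
    · simp
  | succ k ih =>
    have hP : ∀ j ∈ Finset.range m, ∀ l, SmallSimplex n k (k * (2 / m)) l →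
        prism (coneStep m (basisSeq n (k + 1)) j) (coneStep m (basisSeq n (k + 1)) (j + 1)) A l
          = 0 := by
      intro j hj l hl
      have hj' := Finset.mem_range.1 hj
      refine prism_eq_zero fun l' _ hl' => h l' ⟨fun x hx => ?_, fun x hx y hy => ?_⟩
      · obtain ⟨v, hv, rfl | rfl⟩ := hl' x hx
        · exact ⟨coneStep_mem hk hj'.le (hl.1 v hv).1 (hl.1 v hv).2,
            fun i hi => coneStep_apply_of_lt (hl.1 v hv).2 i (by exact_mod_cast hi)⟩
        · exact ⟨coneStep_mem hk hj' (hl.1 v hv).1 (hl.1 v hv).2,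
            fun i hi => coneStep_apply_of_lt (hl.1 v hv).2 i (by exact_mod_cast hi)⟩
      · have hp := norm_le_one_of_mem_l1Sphere (basisSeq_mem hk)
        have hm : (0 : ℝ) ≤ 2 / m := by positivity
        obtain ⟨v, hv, hxv⟩ := hl' x hx
        obtain ⟨w, hw, hyw⟩ := hl' y hy
        have hvw := hl.2 v hv w hw
        have h1 := norm_coneStep_sub_le hj'.le (basisSeq n (k + 1)) v w
        have h2 := norm_coneStep_sub_le hj' (basisSeq n (k + 1)) v w
        have h3 := norm_coneStep_sub_succ_le (m := m) (j := j) hp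
          (norm_le_one_of_mem_l1Sphere (hl.1 w hw).1)
        push_cast
        rcases hxv with rfl | rfl <;> rcases hyw with rfl | rfl
        · linarith
        · linarith [norm_sub_le_norm_sub_add_norm_sub (coneStep m (basisSeq n (k + 1)) j v)
            (coneStep m (basisSeq n (k + 1)) j w) (coneStep m (basisSeq n (k + 1)) (j + 1) w)]
        · rw [norm_sub_rev] at h3
          linarith [norm_sub_le_norm_sub_add_norm_sub (coneStep m (basisSeq n (k + 1)) (j + 1) v)
            (coneStep m (basisSeq n (k + 1)) (j + 1) w) (coneStep m (basisSeq n (k + 1)) j w)]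
        · linarith
    rw [hemisphere]
    refine Finset.sum_eq_zero fun j hj => ?_
    rw [ih (by omega) (hP j hj), ih (by omega), add_zero]
    intro l hl
    refine hP j hj _ ⟨fun x hx => ?_, fun x hx y hy => ?_⟩
    · obtain ⟨v, hv, rfl⟩ := List.mem_map.1 hx
      exact ⟨neg_mem_l1Sphere (hl.1 v hv).1, fun i hi => by simp [(hl.1 v hv).2 i hi]⟩
    · obtain ⟨v, hv, rfl⟩ := List.mem_map.1 hx
      obtain ⟨w, hw, rfl⟩ := List.mem_map.1 hy
      rw [← neg_sub', norm_neg]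
      exact hl.2 v hv w hw

theorem hemisphere_congr {m k : ℕ} (hk : k < n + 1)
    {A A' : List (EuclideanSpace ℝ (Fin (n + 1))) → ZMod 2}
    (h : ∀ l, SmallSimplex n k (k * (2 / m)) l → A l = A' l) :
    hemisphere (basisSeq n) m k A = hemisphere (basisSeq n) m k A' := by
  rw [← CharTwo.add_eq_zero, ← hemisphere_add]
  exact hemisphere_eq_zero hk fun l hl => by rw [h l hl, zmod_two_add_self]

theorem SmallSimplex.neg {k : ℕ} {d : ℝ} {l : List (EuclideanSpace ℝ (Fin (n + 1)))}
    (hl : SmallSimplex n k d l) : SmallSimplex n k d (l.map fun x => -x) := by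
  refine ⟨fun x hx => ?_, fun x hx y hy => ?_⟩
  · obtain ⟨v, hv, rfl⟩ := List.mem_map.1 hx
    exact ⟨neg_mem_l1Sphere (hl.1 v hv).1, fun i hi => by simp [(hl.1 v hv).2 i hi]⟩
  · obtain ⟨v, hv, rfl⟩ := List.mem_map.1 hx
    obtain ⟨w, hw, rfl⟩ := List.mem_map.1 hy
    rw [← neg_sub', norm_neg]
    exact hl.2 v hv w hw

theorem sphereSum_eq_zero {m k : ℕ} (hk : k < n + 1)
    {A : List (EuclideanSpace ℝ (Fin (n + 1))) → ZMod 2}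
    (h : ∀ l, SmallSimplex n k (k * (2 / m)) l → A l = 0) :
    sphereSum (basisSeq n) m k A = 0 := by
  rw [sphereSum, hemisphere_eq_zero hk h, hemisphere_eq_zero hk fun l hl => h _ hl.neg, add_zero]

end L1Sphere

/-! ### Even maps of spheres -/

section EvenMap

variable {n : ℕ}

/-- An index at which a nonnegative vector has a coordinate that is at least `δ`. -/
noncomputable def largeIndex (δ : ℝ) (y : Fin (n + 1) → ℝ) : Fin (n + 1) :=
  open Classical in if h : ∃ i, δ ≤ y i then h.choose else 0

/-- The label of a vector: the index and the sign of a large coordinate. -/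
noncomputable def coordLabel (δ : ℝ) (x : EuclideanSpace ℝ (Fin (n + 1))) : ℕ × Bool :=
  (largeIndex δ fun i => |x i|, decide (0 < x (largeIndex δ fun i => |x i|)))

theorem largeIndex_spec {δ : ℝ} {y : Fin (n + 1) → ℝ} (h : ∃ i, δ ≤ y i) :
    δ ≤ y (largeIndex δ y) := by
  rw [largeIndex, dif_pos h]
  exact h.choose_spec

theorem coordLabel_lt (δ : ℝ) (x : EuclideanSpace ℝ (Fin (n + 1))) :
    (coordLabel δ x).1 < n + 1 := (largeIndex δ fun i => |x i|).2

theorem coordLabel_neg {δ : ℝ} (hδ : 0 < δ) {x : EuclideanSpace ℝ (Fin (n + 1))}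
    (h : ∃ i, δ ≤ |x i|) : coordLabel δ (-x) = ((coordLabel δ x).1, !(coordLabel δ x).2) := by
  have h1 := largeIndex_spec (y := fun i => |x i|) h
  simp only [coordLabel, PiLp.neg_apply, abs_neg]
  generalize largeIndex δ (fun i => |x i|) = i at *
  have h2 : x i ≠ 0 := by
    intro h0
    simp only [h0, abs_zero] at h1
    linarith
  rcases lt_or_gt_of_ne h2 with h3 | h3
  · simp [h3, h3.le]
  · simp [h3, h3.le]

/-- Opposite labels would put the same coordinate at or above `δ` for `x` and at or below `-δ` for
`y`. -/
theorem not_coordLabel_opposite {δ : ℝ} (hδ : 0 < δ) {x y : EuclideanSpace ℝ (Fin (n + 1))}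
    (hx : ∃ i, δ ≤ |x i|) (hy : ∃ i, δ ≤ |y i|) (hxy : ‖x - y‖ < δ) {i : ℕ}
    (h1 : coordLabel δ x = (i, true)) (h2 : coordLabel δ y = (i, false)) : False := by
  have hx' := largeIndex_spec (y := fun i => |x i|) hx
  have hy' := largeIndex_spec (y := fun i => |y i|) hy
  simp only [coordLabel, Prod.mk.injEq, decide_eq_true_eq, decide_eq_false_iff_not, not_lt]
    at h1 h2
  have h3 : largeIndex δ (fun i => |x i|) = largeIndex δ (fun i => |y i|) :=
    Fin.ext (h1.1.trans h2.1.symm)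
  rw [h3] at hx' h1
  generalize largeIndex δ (fun i => |y i|) = j at *
  rw [abs_of_pos h1.2] at hx'
  rw [abs_of_nonpos h2.2] at hy'
  have h4 := PiLp.norm_apply_le (x - y) j
  rw [PiLp.sub_apply, Real.norm_eq_abs] at h4
  linarith [le_abs_self (x j - y j)]

/-- The label count over the sphere is odd for an odd labelling. -/
theorem sphereSum_alternating_of_odd {m k : ℕ} (hm : m ≠ 0) (hk : k < n + 1)
    (lab : EuclideanSpace ℝ (Fin (n + 1)) → ℕ × Bool) (hN : ∀ x, (lab x).1 < n + 1)
    (hodd : ∀ x ∈ l1Sphere n, lab (-x) = ((lab x).1, !(lab x).2))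
    (hcompl : ∀ l, SmallSimplex n k (k * (2 / m)) l → NoComplementary (l.map lab)) (s : Bool) :
    sphereSum (basisSeq n) m k (fun l => alternating s (n + 1) (k + 1) (l.map lab)) = 1 := by
  induction k generalizing s with
  | zero =>
    have h0 := basisSeq_mem (n := n) hk
    -- A single vertex is alternating from exactly one of the two signs.
    have h1 := coboundary_alternating s (n + 1) 0 (l := [lab (basisSeq n 0)])
      (hcompl [basisSeq n 0] (by
        refine ⟨?_, by simp⟩
        intro x hx
        obtain rfl := List.mem_singleton.1 hx
        exact ⟨h0, fun i hi => basisSeq_apply_of_ne hi.ne'⟩)) (by simpa using Nat.lt_succ_iff.1 (hN _))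
    have h2 := alternating_map_flip s (n + 1) 1 [lab (basisSeq n 0)]
    simp only [List.map_cons, List.map_nil] at h2
    simp only [sphereSum, hemisphere, List.map_cons, List.map_nil, hodd _ h0, h2, zero_add]
    rw [← h1]
    simp [coboundary, wedge, alternating_zero]
  | succ k ih =>
    have hflip : ∀ l, SmallSimplex n (k + 1) ((k + 1 : ℕ) * (2 / m)) l →
        alternating s (n + 1) (k + 1 + 1) ((l.map fun x => -x).map lab) =
          alternating (!s) (n + 1) (k + 1 + 1) (l.map lab) := by
      intro l hl
      rw [← alternating_map_flip]
      simp only [List.map_map]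
      congr 1
      refine List.map_congr_left fun x hx => ?_
      simp [hodd x (hl.1 x hx).1]
    -- By oddness the antipodal hemisphere counts the simplices that start with the other sign; both
    -- counts together are a coboundary, and Stokes' formula lowers the dimension.
    have hd : sphereSum (basisSeq n) m (k + 1)
        (fun l => alternating s (n + 1) (k + 1 + 1) (l.map lab)) =
        hemisphere (basisSeq n) m (k + 1)
          (coboundary fun l => alternating s (n + 1) (k + 1) (l.map lab)) := by
      rw [sphereSum, hemisphere_congr hk hflip, ← hemisphere_add]
      refine hemisphere_congr hk fun l hl => ?_
      rw [← coboundary_map, coboundary_alternating s _ _ (hcompl l hl)]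
      intro p hp
      obtain ⟨x, -, rfl⟩ := List.mem_map.1 hp
      exact hN x
    rw [hd, hemisphere_coboundary _ _ hm]
    refine ih (by omega) (fun l hl => hcompl l ⟨fun x hx => ⟨(hl.1 x hx).1, fun i hi =>
      (hl.1 x hx).2 i (by omega)⟩, fun x hx y hy => (hl.2 x hx y hy).trans ?_⟩) s
    push_cast
    have : (0 : ℝ) ≤ 2 / m := by positivity
    linarith

/-- The label count over the sphere does not change between labellings that are nowhere opposite on
small simplices. -/
theorem sphereSum_alternating_eq {m : ℕ} (hm : m ≠ 0)
    (lab lab' : EuclideanSpace ℝ (Fin (n + 1)) → ℕ × Bool)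
    (hN : ∀ x, (lab x).1 < n + 1) (hN' : ∀ x, (lab' x).1 < n + 1)
    (hcompl : ∀ l, SmallSimplex n n (n * (2 / m)) l → ∀ l' : List (ℕ × Bool),
      (∀ p ∈ l', ∃ x ∈ l, p = lab x ∨ p = lab' x) → NoComplementary l') (s : Bool) :
    sphereSum (basisSeq n) m n (fun l => alternating s (n + 1) (n + 1) (l.map lab)) =
      sphereSum (basisSeq n) m n (fun l => alternating s (n + 1) (n + 1) (l.map lab')) := by
  have h0 : sphereSum (basisSeq n) m n
      (prism lab lab' (coboundary (alternating s (n + 1) (n + 1)))) = 0 := by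
    refine sphereSum_eq_zero (Nat.lt_succ_self n) fun l hl => prism_eq_zero fun l' _ hl' => ?_
    -- The top count is a cocycle: an alternating simplex with `n + 2` vertices would need more than
    -- `n + 1` indices.
    rw [coboundary_alternating s _ _ (hcompl l hl l' hl'), alternating_eq_zero _ (Nat.lt_succ_self _),
      alternating_eq_zero _ (Nat.lt_succ_self _), add_zero]
    intro p hp
    obtain ⟨x, -, rfl | rfl⟩ := hl' p hp
    exacts [hN x, hN' x]
  rw [show prism lab lab' (coboundary (alternating s (n + 1) (n + 1))) = _ from
    funext (prism_coboundary lab lab' _), sphereSum_add, sphereSum_coboundary _ _ hm, zero_add,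
    sphereSum_add] at h0
  exact CharTwo.add_eq_zero.1 h0

/-- An even map of a sphere to a Euclidean space of one dimension more is, at some point, a
nonpositive multiple of the identity. -/
theorem exists_segment_eq_zero_of_even
    {b : EuclideanSpace ℝ (Fin (n + 1)) → EuclideanSpace ℝ (Fin (n + 1))}
    (hb : ContinuousOn b (l1Sphere n)) (heven : ∀ x ∈ l1Sphere n, b (-x) = b x) :
    ∃ x ∈ l1Sphere n, ∃ t ∈ Set.Icc (0 : ℝ) 1, (1 - t) • x + t • b x = 0 := by
  by_contra hcon
  push Not at hcon
  set F : EuclideanSpace ℝ (Fin (n + 1)) × ℝ → EuclideanSpace ℝ (Fin (n + 1)) :=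
    fun p => (1 - p.2) • p.1 + p.2 • b p.1 with hF
  have hK : IsCompact (l1Sphere n ×ˢ Set.Icc (0 : ℝ) 1) := (isCompact_l1Sphere n).prod isCompact_Icc
  have hFc : ContinuousOn F (l1Sphere n ×ˢ Set.Icc (0 : ℝ) 1) := by
    have : ContinuousOn (fun p : EuclideanSpace ℝ (Fin (n + 1)) × ℝ => b p.1)
        (l1Sphere n ×ˢ Set.Icc (0 : ℝ) 1) := hb.comp continuousOn_fst fun p hp => hp.1
    exact ((continuousOn_const.sub continuousOn_snd).smul continuousOn_fst).add
      (continuousOn_snd.smul this)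
  have hKne : (l1Sphere n ×ˢ Set.Icc (0 : ℝ) 1).Nonempty :=
    ⟨(basisSeq n 0, 0), basisSeq_mem (Nat.succ_pos n), by simp⟩
  obtain ⟨p0, hp0, hmin⟩ := hK.exists_isMinOn hKne
    (f := fun p => ∑ i, |F p i|) (by fun_prop)
  set c : ℝ := ∑ i, |F p0 i| with hc
  have hc0 : 0 < c := by
    obtain ⟨i, hi⟩ : ∃ i, F p0 i ≠ 0 := by
      by_contra h
      push Not at h
      exact hcon p0.1 hp0.1 p0.2 hp0.2 (PiLp.ext h)
    exact Finset.sum_pos' (fun i _ => abs_nonneg _) ⟨i, Finset.mem_univ _, abs_pos.2 hi⟩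
  -- By averaging, some coordinate of `F` is at least `δ` in absolute value everywhere.
  set δ : ℝ := c / (n + 1) with hδdef
  have hδ : 0 < δ := by positivity
  have hlarge : ∀ x ∈ l1Sphere n, ∀ t ∈ Set.Icc (0 : ℝ) 1, ∃ i, δ ≤ |F (x, t) i| := by
    intro x hx t ht
    by_contra h
    push Not at h
    have h1 : ∑ i, |F (x, t) i| < ∑ _i : Fin (n + 1), δ :=
      Finset.sum_lt_sum_of_nonempty Finset.univ_nonempty fun i _ => h i
    have h2 : c ≤ ∑ i, |F (x, t) i| := hmin (show (x, t) ∈ _ from ⟨hx, ht⟩)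
    have h3 : ∑ _i : Fin (n + 1), δ = c := by
      simp only [Finset.sum_const, Finset.card_univ, Fintype.card_fin, nsmul_eq_mul, hδdef]
      push_cast
      field_simp
    linarith
  obtain ⟨η, hη, hη'⟩ := Metric.uniformContinuousOn_iff.1
    (hK.uniformContinuousOn_of_continuous hFc) δ hδ
  -- This keeps both the diameter `n * (2 / m)` of the simplices and the time step `1 / m` below
  -- `η`.
  obtain ⟨m, hm⟩ := exists_nat_gt ((2 * n + 1) / η)
  have hm0 : (0 : ℝ) < m := lt_of_le_of_lt (by positivity) hm
  have hm0' : m ≠ 0 := by rintro rfl; simp at hm0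
  have hmη : (n : ℝ) * (2 / m) < η ∧ 1 / (m : ℝ) < η := by
    rw [div_lt_iff₀ hη] at hm
    constructor
    · rw [← mul_div_assoc, div_lt_iff₀ hm0]; linarith
    · rw [div_lt_iff₀ hm0]; nlinarith [(Nat.cast_nonneg n : (0 : ℝ) ≤ n)]
  let lab : ℕ → EuclideanSpace ℝ (Fin (n + 1)) → ℕ × Bool :=
    fun j x => coordLabel δ (F (x, (j : ℝ) / m))
  have hIcc : ∀ j : ℕ, j ≤ m → ((j : ℝ) / m) ∈ Set.Icc (0 : ℝ) 1 := fun j hj =>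
    ⟨by positivity, div_le_one_of_le₀ (by exact_mod_cast hj) hm0.le⟩
  have hstep : ∀ j : ℕ, j < m → ∀ l, SmallSimplex n n (n * (2 / m)) l → ∀ l' : List (ℕ × Bool),
      (∀ p ∈ l', ∃ x ∈ l, p = lab j x ∨ p = lab (j + 1) x) → NoComplementary l' := by
    intro j hj l hl l' hl' i h1 h2
    have hd : |(j : ℝ) / m - ((j + 1 : ℕ) : ℝ) / m| < η := by
      have : (j : ℝ) / m - ((j + 1 : ℕ) : ℝ) / m = -(1 / m) := by push_cast; ring
      rw [this, abs_neg, abs_of_pos (by positivity)]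
      exact hmη.2
    have hopp : ∀ x ∈ l, ∀ y ∈ l, ∀ a b : ℕ, a ≤ m → b ≤ m →
        |(a : ℝ) / m - (b : ℝ) / m| < η → lab a x = (i, true) → lab b y = (i, false) → False := by
      intro x hx y hy a b ha hb hab
      refine not_coordLabel_opposite hδ (hlarge x (hl.1 x hx).1 _ (hIcc a ha))
        (hlarge y (hl.1 y hy).1 _ (hIcc b hb)) ?_
      rw [← dist_eq_norm]
      refine hη' _ ⟨(hl.1 x hx).1, hIcc a ha⟩ _ ⟨(hl.1 y hy).1, hIcc b hb⟩ ?_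
      rw [Prod.dist_eq, max_lt_iff]
      refine ⟨?_, by simpa [Real.dist_eq] using hab⟩
      rw [dist_eq_norm]
      exact (hl.2 x hx y hy).trans_lt hmη.1
    obtain ⟨x, hx, hx'⟩ := hl' _ h1
    obtain ⟨y, hy, hy'⟩ := hl' _ h2
    rcases hx' with hx' | hx' <;> rcases hy' with hy' | hy'
    · exact hopp x hx y hy j j hj.le hj.le (by simpa using hη) hx'.symm hy'.symm
    · exact hopp x hx y hy j (j + 1) hj.le hj hd hx'.symm hy'.symm
    · exact hopp x hx y hy (j + 1) j hj hj.le (by rwa [abs_sub_comm]) hx'.symm hy'.symm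
    · exact hopp x hx y hy (j + 1) (j + 1) hj hj (by simpa using hη) hx'.symm hy'.symm
  -- `F` is a homotopy in the complement of `0` from the identity, at `j = 0`, to `b`, at `j = m`.
  -- The label count stays constant, yet it is `1` for an odd labelling and `0` for an even one.
  have hconst : ∀ j : ℕ, j ≤ m →
      sphereSum (basisSeq n) m n (fun l => alternating true (n + 1) (n + 1) (l.map (lab j))) =
        sphereSum (basisSeq n) m n
          (fun l => alternating true (n + 1) (n + 1) (l.map (lab 0))) := by
    intro j
    induction j with
    | zero => intro _; rfl
    | succ j ih =>
      intro hj
      rw [← ih (by omega)]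
      exact (sphereSum_alternating_eq hm0' _ _ (fun x => coordLabel_lt _ _)
        (fun x => coordLabel_lt _ _) (hstep j hj) true).symm
  have hone : sphereSum (basisSeq n) m n
      (fun l => alternating true (n + 1) (n + 1) (l.map (lab 0))) = 1 := by
    refine sphereSum_alternating_of_odd hm0' (Nat.lt_succ_self n) _ (fun x => coordLabel_lt _ _)
      (fun x hx => ?_) (fun l hl => hstep 0 (Nat.pos_of_ne_zero hm0') l hl _ fun p hp => ?_) true
    · have h := hlarge x hx 0 (by simp)
      have h2 := coordLabel_neg hδ h
      simpa [lab, hF] using h2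
    · obtain ⟨x, hx, rfl⟩ := List.mem_map.1 hp
      exact ⟨x, hx, Or.inl rfl⟩
  have hzero : sphereSum (basisSeq n) m n
      (fun l => alternating true (n + 1) (n + 1) (l.map (lab m))) = 0 := by
    have hmm : (m : ℝ) / m = 1 := div_self hm0.ne'
    rw [sphereSum, hemisphere_congr (n := n) (Nat.lt_succ_self n) (A := fun l =>
      alternating true (n + 1) (n + 1) ((l.map fun x => -x).map (lab m)))
      (A' := fun l => alternating true (n + 1) (n + 1) (l.map (lab m))), zmod_two_add_self]
    intro l hl
    simp only [List.map_map]
    congr 1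
    refine List.map_congr_left fun x hx => ?_
    simp [lab, hF, hmm, heven x (hl.1 x hx).1]
  rw [hconst m le_rfl, hone] at hzero
  exact one_ne_zero hzero

end EvenMap

/-! ### Positions of one support function inside another -/

section Positions

/-- Continuous, positively homogeneous functions with positive width in every direction; for
instance the support function of a convex body. -/
structure SupportLike {E : Type*} [NormedAddCommGroup E] [NormedSpace ℝ E] (h : E → ℝ) :
    Prop where
  continuous : Continuous h
  map_smul : ∀ c : ℝ, 0 ≤ c → ∀ x, h (c • x) = c * h x
  width_pos : ∀ x, x ≠ 0 → 0 < h x + h (-x)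

/-- The width of a body with support function `h`. -/
def width {E : Type*} [Neg E] (h : E → ℝ) (x : E) : ℝ := h x + h (-x)

/-- The linear maps along which `h` pulls back to `k` up to a linear functional. -/
def positions {Y E : Type*} [NormedAddCommGroup Y] [NormedSpace ℝ Y] [NormedAddCommGroup E]
    [NormedSpace ℝ E] (h : E → ℝ) (k : Y → ℝ) : Set (Y →L[ℝ] E) :=
  {L | ∃ ℓ : Y →ₗ[ℝ] ℝ, ∀ y, h (L y) = k y + ℓ y}

variable {Y E F : Type*} [NormedAddCommGroup Y] [NormedSpace ℝ Y] [NormedAddCommGroup E]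
  [NormedSpace ℝ E] [NormedAddCommGroup F] [NormedSpace ℝ F] {h : E → ℝ} {k : Y → ℝ} {f : F → ℝ}

/-- The even part does not see the linear functional, so widths are preserved exactly; all bounds on
positions come from this. -/
theorem width_apply_of_mem_positions {L : Y →L[ℝ] E} (hL : L ∈ positions h k) (y : Y) :
    width h (L y) = width k y := by
  obtain ⟨ℓ, hℓ⟩ := hL
  simp only [width, ← map_neg L, hℓ]
  simp only [map_neg]
  ring

theorem comp_mem_positions {L : Y →L[ℝ] E} (hL : L ∈ positions h k) {g : F →L[ℝ] Y}
    (hg : g ∈ positions k f) : L.comp g ∈ positions h f := by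
  obtain ⟨ℓ, hℓ⟩ := hL
  obtain ⟨ℓ', hℓ'⟩ := hg
  refine ⟨ℓ' + ℓ.comp g.toLinearMap, fun y => ?_⟩
  simp [hℓ, hℓ', add_assoc]

theorem mem_positions_of_comp {L : Y →L[ℝ] E} (hL : L ∈ positions h k) {g : F →L[ℝ] Y}
    (hg : L.comp g ∈ positions h f) : g ∈ positions k f := by
  obtain ⟨ℓ, hℓ⟩ := hL
  obtain ⟨ℓ', hℓ'⟩ := hg
  refine ⟨ℓ' - ℓ.comp g.toLinearMap, fun y => ?_⟩
  have h1 := hℓ' y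
  simp only [ContinuousLinearMap.comp_apply, hℓ] at h1
  simp only [LinearMap.sub_apply, LinearMap.comp_apply, ContinuousLinearMap.coe_coe]
  linarith

theorem id_mem_positions : ContinuousLinearMap.id ℝ Y ∈ positions k k := ⟨0, by simp⟩

namespace SupportLike

theorem map_zero (hh : SupportLike h) : h 0 = 0 := by
  simpa using hh.map_smul 0 le_rfl 0

theorem width_zero (hh : SupportLike h) : width h 0 = 0 := by simp [width, hh.map_zero]

theorem continuous_width (hh : SupportLike h) : Continuous (width h) := by
  have := hh.continuous
  unfold width
  fun_prop

theorem width_smul (hh : SupportLike h) {c : ℝ} (hc : 0 ≤ c) (x : E) :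
    width h (c • x) = c * width h x := by
  simp only [width, ← smul_neg, hh.map_smul c hc]
  ring

theorem exists_le_width [FiniteDimensional ℝ E] (hh : SupportLike h) :
    ∃ c > 0, ∀ x, c * ‖x‖ ≤ width h x := by
  rcases subsingleton_or_nontrivial E with hE | hE
  · exact ⟨1, one_pos, fun x => by simp [Subsingleton.elim x 0, hh.width_zero]⟩
  obtain ⟨x0, hx0, hmin⟩ := (isCompact_sphere (0 : E) 1).exists_isMinOn
    (NormedSpace.sphere_nonempty.2 zero_le_one) hh.continuous_width.continuousOn
  refine ⟨width h x0, hh.width_pos x0 ?_, fun x => ?_⟩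
  · rintro rfl
    simp at hx0
  · rcases eq_or_ne x 0 with rfl | hx
    · simp [hh.width_zero]
    have h1 : width h x0 ≤ width h (‖x‖⁻¹ • x) :=
      hmin (show _ ∈ Metric.sphere (0 : E) 1 by simp [norm_smul, hx])
    rw [hh.width_smul (by positivity), inv_mul_eq_div, le_div_iff₀ (norm_pos_iff.2 hx)] at h1
    exact h1

theorem exists_width_le [FiniteDimensional ℝ E] (hh : SupportLike h) :
    ∃ c > 0, ∀ x, width h x ≤ c * ‖x‖ := by
  rcases subsingleton_or_nontrivial E with hE | hE
  · exact ⟨1, one_pos, fun x => by simp [Subsingleton.elim x 0, hh.width_zero]⟩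
  obtain ⟨x0, hx0, hmax⟩ := (isCompact_sphere (0 : E) 1).exists_isMaxOn
    (NormedSpace.sphere_nonempty.2 zero_le_one) hh.continuous_width.continuousOn
  refine ⟨width h x0, hh.width_pos x0 ?_, fun x => ?_⟩
  · rintro rfl
    simp at hx0
  · rcases eq_or_ne x 0 with rfl | hx
    · simp [hh.width_zero]
    have h1 : width h (‖x‖⁻¹ • x) ≤ width h x0 :=
      hmax (show _ ∈ Metric.sphere (0 : E) 1 by simp [norm_smul, hx])
    rw [hh.width_smul (by positivity), inv_mul_eq_div, div_le_iff₀ (norm_pos_iff.2 hx)] at h1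
    exact h1

theorem eq_zero_of_width_le (hh : SupportLike h) {x : E} (hx : width h x ≤ 0) : x = 0 := by
  by_contra h0
  exact not_lt.2 hx (hh.width_pos x h0)

end SupportLike

theorem exists_norm_le_of_positions [FiniteDimensional ℝ E] [FiniteDimensional ℝ Y]
    (hh : SupportLike h) (hk : SupportLike k) :
    ∃ c > 0, ∀ L ∈ positions h k, ∀ y, ‖y‖ ≤ c * ‖L y‖ := by
  obtain ⟨c1, hc1, h1⟩ := hk.exists_le_width
  obtain ⟨c2, hc2, h2⟩ := hh.exists_width_le
  refine ⟨c2 / c1, by positivity, fun L hL y => ?_⟩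
  have := width_apply_of_mem_positions hL y
  rw [div_mul_eq_mul_div, le_div_iff₀ hc1]
  linarith [h1 y, h2 (L y)]

theorem injective_of_mem_positions (hh : SupportLike h) (hk : SupportLike k) {L : Y →L[ℝ] E}
    (hL : L ∈ positions h k) : Function.Injective L := by
  refine (injective_iff_map_eq_zero L).2 fun y hy => hk.eq_zero_of_width_le ?_
  rw [← width_apply_of_mem_positions hL, hy, hh.width_zero]

/-- The existence of the functional is rewritten as additivity and homogeneity of `h ∘ L - k`, which
are closed conditions on `L`. -/
theorem isClosed_positions (hh : SupportLike h) : IsClosed (positions h k) := by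
  have : positions h k = {L | (∀ x y, h (L (x + y)) - k (x + y) =
      (h (L x) - k x) + (h (L y) - k y)) ∧
      ∀ (c : ℝ) (x), h (L (c • x)) - k (c • x) = c * (h (L x) - k x)} := by
    ext L
    constructor
    · rintro ⟨ℓ, hℓ⟩
      exact ⟨fun x y => by simp only [hℓ]; simp,
        fun c x => by simp only [hℓ]; simp⟩
    · rintro ⟨h1, h2⟩
      exact ⟨{ toFun := fun y => h (L y) - k y, map_add' := h1, map_smul' := h2 },
        fun y => by simp⟩
  have hc := hh.continuous
  rw [this]
  simp only [Set.ofPred_and, Set.ofPred_forall]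
  refine IsClosed.inter ?_ ?_
  · refine isClosed_iInter fun x => isClosed_iInter fun y => isClosed_eq ?_ ?_ <;> fun_prop
  · refine isClosed_iInter fun c => isClosed_iInter fun x => isClosed_eq ?_ ?_ <;> fun_prop

theorem isCompact_positions [FiniteDimensional ℝ E] [FiniteDimensional ℝ Y]
    (hh : SupportLike h) (hk : SupportLike k) : IsCompact (positions h k) := by
  refine Metric.isCompact_of_isClosed_isBounded (isClosed_positions hh) ?_
  obtain ⟨c1, hc1, h1⟩ := hh.exists_le_width
  obtain ⟨c2, hc2, h2⟩ := hk.exists_width_le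
  refine (Metric.isBounded_iff_subset_closedBall 0).2 ⟨c2 / c1, fun L hL => ?_⟩
  rw [mem_closedBall_zero_iff]
  refine L.opNorm_le_bound (by positivity) fun y => ?_
  have := width_apply_of_mem_positions hL y
  rw [div_mul_eq_mul_div, le_div_iff₀ hc1]
  linarith [h1 (L y), h2 y]

/-- With `comp_mem_positions` and `id_mem_positions` this makes `positions k k` a group. -/
theorem exists_inverse_of_mem_positions [FiniteDimensional ℝ Y] (hk : SupportLike k)
    {g : Y →L[ℝ] Y} (hg : g ∈ positions k k) :
    ∃ g' ∈ positions k k, g.comp g' = ContinuousLinearMap.id ℝ Y ∧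
      g'.comp g = ContinuousLinearMap.id ℝ Y := by
  have hinj := injective_of_mem_positions hk hk hg
  let e := LinearEquiv.ofInjectiveEndo g.toLinearMap hinj
  have he : ∀ y, e y = g y := fun y => rfl
  let g' : Y →L[ℝ] Y := LinearMap.toContinuousLinearMap e.symm.toLinearMap
  have h1 : g.comp g' = ContinuousLinearMap.id ℝ Y := by
    ext y
    exact e.apply_symm_apply y
  refine ⟨g', mem_positions_of_comp hg (by rw [h1]; exact id_mem_positions), h1, ?_⟩
  ext y
  exact e.symm_apply_apply y

/-- The body of vectors of width at most one. -/
def widthBody (k : Y → ℝ) : Set Y := {y | width k y ≤ 1}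

theorem isCompact_widthBody [FiniteDimensional ℝ Y] (hk : SupportLike k) : IsCompact (widthBody k) := by
  refine Metric.isCompact_of_isClosed_isBounded
    (isClosed_le hk.continuous_width continuous_const) ?_
  obtain ⟨c, hc, h⟩ := hk.exists_le_width
  refine (Metric.isBounded_iff_subset_closedBall 0).2 ⟨1 / c, fun y hy => ?_⟩
  rw [mem_closedBall_zero_iff, le_div_iff₀ hc, mul_comm]
  exact (h y).trans hy

end Positions

/-! ### An invariant inner product on linear maps -/

section Form

open MeasureTheory

variable {Y E : Type*} [NormedAddCommGroup Y] [InnerProductSpace ℝ Y] [FiniteDimensional ℝ Y]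
  [MeasurableSpace Y] [BorelSpace Y] [NormedAddCommGroup E] [InnerProductSpace ℝ E]
  [FiniteDimensional ℝ E] {k : Y → ℝ}

theorem volume_widthBody_pos (hk : SupportLike k) {U : Set Y} (hU : IsOpen U)
    (hcone : ∃ y ∈ U, ∀ c : ℝ, 0 < c → c • y ∈ U) : 0 < volume (U ∩ widthBody k) := by
  obtain ⟨y, -, hy⟩ := hcone
  have hopen : IsOpen (U ∩ {y | width k y < 1}) :=
    hU.inter (isOpen_lt hk.continuous_width continuous_const)
  have hne : (U ∩ {y | width k y < 1}).Nonempty := by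
    have h0 : 0 ≤ width k y := by
      rcases eq_or_ne y 0 with rfl | h
      · exact hk.width_zero.ge
      · exact (hk.width_pos y h).le
    have hc : 0 < (width k y + 1)⁻¹ := by positivity
    refine ⟨(width k y + 1)⁻¹ • y, hy _ hc, ?_⟩
    rw [Set.mem_ofPred_eq, hk.width_smul hc.le, inv_mul_lt_iff₀ (by positivity)]
    linarith
  refine (hopen.measure_pos volume hne).trans_le (measure_mono ?_)
  exact Set.inter_subset_inter_right _ fun y (hy : width k y < 1) => hy.le

/-- A symmetry preserves `widthBody k`, whose volume is positive and finite, so its determinant is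
`1` or `-1`. -/
theorem measurePreserving_of_mem_positions (hk : SupportLike k) {g : Y →L[ℝ] Y}
    (hg : g ∈ positions k k) : MeasurePreserving g (volume : Measure Y) volume := by
  have hinj := injective_of_mem_positions hk hk hg
  have hdet : LinearMap.det (g : Y →ₗ[ℝ] Y) ≠ 0 :=
    (LinearEquiv.ofInjectiveEndo g.toLinearMap hinj).isUnit_det'.ne_zero
  have hpre : (g : Y →ₗ[ℝ] Y) ⁻¹' widthBody k = widthBody k := by
    ext y
    simp only [widthBody, Set.mem_preimage, Set.mem_ofPred_eq]
    rw [show width k ((g : Y →ₗ[ℝ] Y) y) = width k y from width_apply_of_mem_positions hg y]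
  have h1 := Measure.addHaar_preimage_linearMap (volume : Measure Y) hdet (widthBody k)
  rw [hpre] at h1
  have hpos : 0 < volume (widthBody k) := by
    simpa using volume_widthBody_pos hk isOpen_univ ⟨0, by simp⟩
  have hfin : volume (widthBody k) ≠ ⊤ := (isCompact_widthBody hk).measure_lt_top.ne
  have h2 : ENNReal.ofReal |(LinearMap.det (g : Y →ₗ[ℝ] Y))⁻¹| = 1 := by
    have h3 : 1 * volume (widthBody k) =
      ENNReal.ofReal |(LinearMap.det (g : Y →ₗ[ℝ] Y))⁻¹| * volume (widthBody k) := by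
      rw [one_mul]; exact h1
    exact ((ENNReal.mul_left_inj hpos.ne' hfin).1 h3).symm
  refine ⟨g.continuous.measurable, ?_⟩
  have h3 := Measure.map_linearMap_addHaar_eq_smul_addHaar (volume : Measure Y) hdet
  rw [h2, one_smul] at h3
  exact h3

theorem setIntegral_widthBody_comp (hk : SupportLike k) {g : Y →L[ℝ] Y}
    (hg : g ∈ positions k k) (φ : Y → ℝ) :
    ∫ y in widthBody k, φ (g y) = ∫ y in widthBody k, φ y := by
  have hpre : g ⁻¹' widthBody k = widthBody k := by
    ext y
    simp only [widthBody, Set.mem_preimage, Set.mem_ofPred_eq, width_apply_of_mem_positions hg y]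
  have hemb : MeasurableEmbedding g := by
    have hinj := injective_of_mem_positions hk hk hg
    exact (LinearMap.isClosedEmbedding_of_injective (f := g.toLinearMap)
      (LinearMap.ker_eq_bot.2 hinj)).measurableEmbedding
  rw [← (measurePreserving_of_mem_positions hk hg).setIntegral_preimage_emb hemb φ (widthBody k),
    hpre]

theorem integrableOn_widthBody (hk : SupportLike k) {φ : Y → ℝ} (hφ : Continuous φ) :
    IntegrableOn φ (widthBody k) :=
  hφ.continuousOn.integrableOn_compact (isCompact_widthBody hk)

/-- The inner product of linear maps obtained by averaging over the body of vectors of width at most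
one. -/
noncomputable def averageForm (E : Type*) [NormedAddCommGroup E] [InnerProductSpace ℝ E]
    [FiniteDimensional ℝ E] (hk : SupportLike k) : (Y →L[ℝ] E) →L[ℝ] (Y →L[ℝ] E) →L[ℝ] ℝ :=
  LinearMap.toContinuousBilinearMap <| LinearMap.mk₂ ℝ (fun A C => ∫ y in widthBody k, inner ℝ (A y) (C y))
    (fun A A' C => by
      simp only [add_apply, inner_add_left]
      exact integral_add (integrableOn_widthBody hk (by fun_prop))
        (integrableOn_widthBody hk (by fun_prop)))
    (fun c A C => by
      simp only [smul_apply, real_inner_smul_left]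
      exact integral_const_mul _ _)
    (fun A C C' => by
      simp only [add_apply, inner_add_right]
      exact integral_add (integrableOn_widthBody hk (by fun_prop))
        (integrableOn_widthBody hk (by fun_prop)))
    (fun c A C => by
      simp only [smul_apply, real_inner_smul_right]
      exact integral_const_mul _ _)

theorem averageForm_apply (hk : SupportLike k) (A C : Y →L[ℝ] E) :
    averageForm E hk A C = ∫ y in widthBody k, inner ℝ (A y) (C y) := rfl

theorem averageForm_comm (hk : SupportLike k) (A C : Y →L[ℝ] E) :
    averageForm E hk A C = averageForm E hk C A := by
  simp only [averageForm_apply, real_inner_comm]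

theorem averageForm_comp (hk : SupportLike k) {g : Y →L[ℝ] Y} (hg : g ∈ positions k k)
    (A C : Y →L[ℝ] E) : averageForm E hk (A.comp g) (C.comp g) = averageForm E hk A C :=
  setIntegral_widthBody_comp hk hg fun y => inner ℝ (A y) (C y)

theorem averageForm_self_nonneg (hk : SupportLike k) (A : Y →L[ℝ] E) :
    0 ≤ averageForm E hk A A :=
  integral_nonneg fun _ => real_inner_self_nonneg

theorem averageForm_self_pos (hk : SupportLike k) {A : Y →L[ℝ] E} (hA : A ≠ 0) :
    0 < averageForm E hk A A := by
  rw [averageForm_apply, setIntegral_pos_iff_support_of_nonneg_ae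
    (Filter.Eventually.of_forall fun _ => real_inner_self_nonneg)
    (integrableOn_widthBody hk (by fun_prop))]
  obtain ⟨y, hy⟩ : ∃ y, A y ≠ 0 := by
    by_contra h
    push Not at h
    exact hA (ContinuousLinearMap.ext h)
  refine volume_widthBody_pos hk ?_ ⟨y, ?_, fun c hc => ?_⟩
  · exact (show Continuous fun y => inner ℝ (A y) (A y) by fun_prop).isOpen_support
  · simpa using hy
  · simpa [hc.ne'] using hy

end Form

/-! ### Positions in a given hyperplane -/

section PositionsAt

variable {Y E : Type*} [NormedAddCommGroup Y] [NormedSpace ℝ Y] [NormedAddCommGroup E]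
  [InnerProductSpace ℝ E] {h : E → ℝ} {k : Y → ℝ}

/-- The positions whose range is orthogonal to `u`. -/
def positionsAt (h : E → ℝ) (k : Y → ℝ) (u : E) : Set (Y →L[ℝ] E) :=
  {L | L ∈ positions h k ∧ ∀ y, inner ℝ u (L y) = 0}

theorem comp_mem_positionsAt {u : E} {L : Y →L[ℝ] E} (hL : L ∈ positionsAt h k u)
    {g : Y →L[ℝ] Y} (hg : g ∈ positions k k) : L.comp g ∈ positionsAt h k u :=
  ⟨comp_mem_positions hL.1 hg, fun y => hL.2 (g y)⟩

/-- By dimension the range of `L` is all of the hyperplane `uᗮ`, so `L'` factors through `L`. -/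
theorem exists_comp_eq_of_mem_positionsAt [FiniteDimensional ℝ Y] [FiniteDimensional ℝ E]
    (hh : SupportLike h) (hk : SupportLike k)
    (hdim : Module.finrank ℝ E = Module.finrank ℝ Y + 1) {u : E} (hu : u ≠ 0)
    {L L' : Y →L[ℝ] E} (hL : L ∈ positionsAt h k u) (hL' : L' ∈ positionsAt h k u) :
    ∃ g ∈ positions k k, L' = L.comp g := by
  have hinj := injective_of_mem_positions hh hk hL.1
  have : Fact (Module.finrank ℝ E = Module.finrank ℝ Y + 1) := ⟨hdim⟩
  have hrange : LinearMap.range L.toLinearMap = (ℝ ∙ u)ᗮ := by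
    refine Submodule.eq_of_le_of_finrank_eq ?_ ?_
    · rintro _ ⟨y, rfl⟩
      exact Submodule.mem_orthogonal_singleton_iff_inner_right.2 (hL.2 y)
    · rw [LinearMap.finrank_range_of_inj hinj,
        Submodule.finrank_orthogonal_span_singleton (n := Module.finrank ℝ Y) hu]
  have hmem : ∀ y, L'.toLinearMap y ∈ LinearMap.range L.toLinearMap := fun y => by
    rw [hrange]
    exact Submodule.mem_orthogonal_singleton_iff_inner_right.2 (hL'.2 y)
  let g : Y →L[ℝ] Y := LinearMap.toContinuousLinearMap
    ((LinearEquiv.ofInjective L.toLinearMap hinj).symm.toLinearMap.comp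
      (L'.toLinearMap.codRestrict _ hmem))
  have hg : L' = L.comp g := by
    ext y
    have h1 := congrArg Subtype.val ((LinearEquiv.ofInjective L.toLinearMap hinj).apply_symm_apply
      (L'.toLinearMap.codRestrict _ hmem y))
    exact h1.symm
  exact ⟨g, mem_positions_of_comp hL.1 (hg ▸ hL'.1), hg⟩

theorem isClosed_positionsAt_prod (hh : SupportLike h) :
    IsClosed {p : E × (Y →L[ℝ] E) | p.2 ∈ positionsAt h k p.1} := by
  have : {p : E × (Y →L[ℝ] E) | p.2 ∈ positionsAt h k p.1} =
      (Prod.snd ⁻¹' positions h k) ∩ ⋂ y : Y, {p | inner ℝ p.1 (p.2 y) = 0} := by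
    ext p
    simp [positionsAt]
  rw [this]
  exact ((isClosed_positions hh).preimage continuous_snd).inter
    (isClosed_iInter fun y => isClosed_eq (by fun_prop) continuous_const)

open Filter Topology in
theorem mem_positionsAt_of_tendsto (hh : SupportLike h) {ι : Type*} {l : Filter ι} [l.NeBot]
    {u : ι → E} {u0 : E} {C : ι → Y →L[ℝ] E} {C0 : Y →L[ℝ] E} (hu : Tendsto u l (𝓝 u0))
    (hC : Tendsto C l (𝓝 C0)) (hmem : ∀ i, C i ∈ positionsAt h k (u i)) :
    C0 ∈ positionsAt h k u0 :=
  (isClosed_positionsAt_prod (k := k) hh).mem_of_tendsto (hu.prodMk_nhds hC)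
    (Eventually.of_forall hmem)

end PositionsAt

/-! ### Continuous choice of positions by nearest points -/

section Lift

open Filter Topology

variable {Y E : Type*} [NormedAddCommGroup Y] [InnerProductSpace ℝ Y] [FiniteDimensional ℝ Y]
  [MeasurableSpace Y] [BorelSpace Y] [NormedAddCommGroup E] [InnerProductSpace ℝ E]
  [FiniteDimensional ℝ E] {h : E → ℝ} {k : Y → ℝ}

theorem exists_le_averageForm_self (hk : SupportLike k) :
    ∃ c > 0, ∀ A : Y →L[ℝ] E, c * ‖A‖ ^ 2 ≤ averageForm E hk A A := by
  rcases subsingleton_or_nontrivial (Y →L[ℝ] E) with hE | hE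
  · exact ⟨1, one_pos, fun x => by simp [Subsingleton.elim x 0]⟩
  obtain ⟨A0, hA0, hmin⟩ := (isCompact_sphere (0 : Y →L[ℝ] E) 1).exists_isMinOn
    (NormedSpace.sphere_nonempty.2 zero_le_one)
    (f := fun A => averageForm E hk A A) (by fun_prop)
  refine ⟨averageForm E hk A0 A0, averageForm_self_pos hk ?_, fun A => ?_⟩
  · rintro rfl
    simp at hA0
  · rcases eq_or_ne A 0 with rfl | hA
    · simp
    have h1 : averageForm E hk A0 A0 ≤ averageForm E hk (‖A‖⁻¹ • A) (‖A‖⁻¹ • A) :=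
      hmin (show _ ∈ Metric.sphere (0 : Y →L[ℝ] E) 1 by simp [norm_smul, hA])
    have h2 : 0 < ‖A‖ := norm_pos_iff.2 hA
    simp only [map_smul, smul_apply, smul_eq_mul] at h1
    calc averageForm E hk A0 A0 * ‖A‖ ^ 2
        ≤ (‖A‖⁻¹ * (‖A‖⁻¹ * averageForm E hk A A)) * ‖A‖ ^ 2 := by gcongr
      _ = averageForm E hk A A := by field_simp

theorem tendsto_zero_of_averageForm_self (hk : SupportLike k) {ι : Type*} {l : Filter ι}
    {A : ι → Y →L[ℝ] E} (hA : Tendsto (fun i => averageForm E hk (A i) (A i)) l (𝓝 0)) :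
    Tendsto A l (𝓝 0) := by
  obtain ⟨c, hc, hle⟩ := exists_le_averageForm_self (E := E) hk
  rw [tendsto_zero_iff_norm_tendsto_zero]
  have h1 : Tendsto (fun i => Real.sqrt (c⁻¹ * averageForm E hk (A i) (A i))) l (𝓝 0) := by
    have := (hA.const_mul c⁻¹).sqrt
    simpa using this
  refine squeeze_zero (fun i => norm_nonneg _) (fun i => ?_) h1
  refine Real.le_sqrt_of_sq_le ?_
  rw [inv_mul_eq_div, le_div_iff₀ hc, mul_comm]
  exact hle _

section TangentDirection

variable {g : ℕ → Y →L[ℝ] Y} {κ : Y →L[ℝ] Y}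

/-- `κ` is a tangent direction of the symmetry group at the identity; differentiating the invariance
of the form along it shows that `κ` acts skew-symmetrically. -/
theorem averageForm_comp_add_comp_eq_zero (hk : SupportLike k) (hg : ∀ j, g j ∈ positions k k)
    (hlim : Tendsto g atTop (𝓝 (ContinuousLinearMap.id ℝ Y)))
    (hκ : Tendsto (fun j => ‖g j - ContinuousLinearMap.id ℝ Y‖⁻¹ •
      (g j - ContinuousLinearMap.id ℝ Y)) atTop (𝓝 κ)) (A C : Y →L[ℝ] E) :
    averageForm E hk (A.comp κ) C + averageForm E hk A (C.comp κ) = 0 := by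
  have h1 : ∀ j, averageForm E hk (A.comp (‖g j - ContinuousLinearMap.id ℝ Y‖⁻¹ •
      (g j - ContinuousLinearMap.id ℝ Y))) (C.comp (g j)) + averageForm E hk A
      (C.comp (‖g j - ContinuousLinearMap.id ℝ Y‖⁻¹ • (g j - ContinuousLinearMap.id ℝ Y))) = 0 := by
    intro j
    have h2 := averageForm_comp hk (hg j) A C
    simp only [ContinuousLinearMap.comp_smul, ContinuousLinearMap.comp_sub, map_smul, map_sub,
      smul_apply, sub_apply, ContinuousLinearMap.comp_id, smul_eq_mul]
    rw [h2]
    ring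
  have h3 : Continuous fun p : (Y →L[ℝ] Y) × (Y →L[ℝ] Y) =>
      averageForm E hk (A.comp p.1) (C.comp p.2) + averageForm E hk A (C.comp p.1) := by fun_prop
  have h4 := (h3.tendsto (κ, ContinuousLinearMap.id ℝ Y)).comp (hκ.prodMk_nhds hlim)
  refine tendsto_nhds_unique (h4.congr' (Eventually.of_forall fun j => ?_)) tendsto_const_nhds
  exact h1 j

/-- The first-order condition at a maximum. The difference quotients of `g j` give one inequality;
those of the inverses tend to `-κ` and give the other. -/
theorem averageForm_comp_eq_zero_of_isMax (hk : SupportLike k) (hg : ∀ j, g j ∈ positions k k)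
    (hg1 : ∀ j, g j ≠ ContinuousLinearMap.id ℝ Y)
    (hlim : Tendsto g atTop (𝓝 (ContinuousLinearMap.id ℝ Y)))
    (hκ : Tendsto (fun j => ‖g j - ContinuousLinearMap.id ℝ Y‖⁻¹ •
      (g j - ContinuousLinearMap.id ℝ Y)) atTop (𝓝 κ)) {A C : Y →L[ℝ] E}
    (hmax : ∀ f ∈ positions k k, averageForm E hk A (C.comp f) ≤ averageForm E hk A C) :
    averageForm E hk A (C.comp κ) = 0 := by
  have hpos : ∀ j, 0 < ‖g j - ContinuousLinearMap.id ℝ Y‖⁻¹ := fun j =>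
    inv_pos.2 (norm_pos_iff.2 (sub_ne_zero.2 (hg1 j)))
  apply le_antisymm
  · have h1 : Continuous fun p : Y →L[ℝ] Y => averageForm E hk A (C.comp p) := by fun_prop
    refine le_of_tendsto ((h1.tendsto κ).comp hκ) (Eventually.of_forall fun j => ?_)
    have h2 := hmax _ (hg j)
    simp only [Function.comp_apply, ContinuousLinearMap.comp_smul, ContinuousLinearMap.comp_sub,
      map_smul, map_sub, ContinuousLinearMap.comp_id, smul_eq_mul]
    exact mul_nonpos_of_nonneg_of_nonpos (hpos j).le (by linarith)
  · choose f hf hgf hfg using fun j => exists_inverse_of_mem_positions hk (hg j)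
    have hfsub : ∀ j, f j - ContinuousLinearMap.id ℝ Y =
        -((f j).comp (g j - ContinuousLinearMap.id ℝ Y)) := by
      intro j
      rw [ContinuousLinearMap.comp_sub, hfg, ContinuousLinearMap.comp_id]
      abel
    have hflim : Tendsto f atTop (𝓝 (ContinuousLinearMap.id ℝ Y)) := by
      obtain ⟨R, hR⟩ := (isCompact_positions hk hk).isBounded.exists_norm_le
      rw [tendsto_iff_norm_sub_tendsto_zero] at hlim ⊢
      refine squeeze_zero (fun j => norm_nonneg _) (fun j => ?_)
        (by simpa using hlim.const_mul R)
      rw [hfsub, norm_neg]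
      exact (ContinuousLinearMap.opNorm_comp_le _ _).trans (by gcongr; exact hR _ (hf j))
    have h1 : Continuous fun p : (Y →L[ℝ] Y) × (Y →L[ℝ] Y) =>
      averageForm E hk A (C.comp (p.1.comp p.2)) := by fun_prop
    have h2 := (h1.tendsto (ContinuousLinearMap.id ℝ Y, κ)).comp (hflim.prodMk_nhds hκ)
    rw [ContinuousLinearMap.id_comp] at h2
    refine ge_of_tendsto h2 (Eventually.of_forall fun j => ?_)
    have h3 := hmax _ (hf j)
    have h4 : averageForm E hk A (C.comp (f j)) - averageForm E hk A C =
        - averageForm E hk A (C.comp ((f j).comp (g j - ContinuousLinearMap.id ℝ Y))) := by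
      rw [← map_sub, ← map_neg, ← ContinuousLinearMap.comp_neg, ← hfsub,
        ContinuousLinearMap.comp_sub, ContinuousLinearMap.comp_id]
    simp only [Function.comp_apply, ContinuousLinearMap.comp_smul, map_smul, smul_eq_mul]
    exact mul_nonneg (hpos j).le (by linarith)

end TangentDirection

/-- `C` is a point of `positionsAt h k u` nearest to `A`. -/
def IsNearest (h : E → ℝ) (hk : SupportLike k) (u : E) (A C : Y →L[ℝ] E) : Prop :=
  C ∈ positionsAt h k u ∧ ∀ C' ∈ positionsAt h k u,
    averageForm E hk (A - C) (A - C) ≤ averageForm E hk (A - C') (A - C')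

/-- Symmetries do not change the length of `C`, so the nearest point of an orbit maximizes the inner
product with `A`. -/
theorem IsNearest.averageForm_comp_le {hk : SupportLike k} {u : E} {A C : Y →L[ℝ] E}
    (hC : IsNearest h hk u A C) (g : Y →L[ℝ] Y) (hg : g ∈ positions k k) :
    averageForm E hk A (C.comp g) ≤ averageForm E hk A C := by
  have h1 := hC.2 _ (comp_mem_positionsAt hC.1 hg)
  have h2 := averageForm_comp hk hg C C
  simp only [map_sub, sub_apply, averageForm_comm hk _ A] at h1
  linarith

/-- A tubular neighbourhood of uniform radius. If uniqueness failed arbitrarily close to the orbits,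
the two nearest points would differ by symmetries tending to the identity, with a limiting unit
direction `κ`; the first-order conditions at both points force `κ = 0`. -/
theorem exists_forall_isNearest_eq (hh : SupportLike h) (hk : SupportLike k)
    (hdim : Module.finrank ℝ E = Module.finrank ℝ Y + 1) :
    ∃ η > 0, ∀ u : E, u ≠ 0 → ∀ A C C' : Y →L[ℝ] E, IsNearest h hk u A C → IsNearest h hk u A C' →
      averageForm E hk (A - C) (A - C) < η → C = C' := by
  by_contra hcon
  push Not at hcon
  choose u hu A C C' hC hC' hlt hne using fun j : ℕ =>
    hcon (1 / ((j : ℝ) + 1)) Nat.one_div_pos_of_nat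
  choose g hg hCg using fun j => exists_comp_eq_of_mem_positionsAt hh hk hdim (hu j) (hC j).1 (hC' j).1
  have hg1 : ∀ j, g j ≠ ContinuousLinearMap.id ℝ Y := fun j hj => hne j (by rw [hCg, hj]; simp)
  set D : ℕ → Y →L[ℝ] Y := fun j => g j - ContinuousLinearMap.id ℝ Y with hD
  have hDpos : ∀ j, 0 < ‖D j‖ := fun j => norm_pos_iff.2 (sub_ne_zero.2 (hg1 j))
  have hAC : Tendsto (fun j => A j - C j) atTop (𝓝 0) :=
    tendsto_zero_of_averageForm_self hk (squeeze_zero (fun j => averageForm_self_nonneg hk _)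
      (fun j => (hlt j).le) tendsto_one_div_add_atTop_nhds_zero_nat)
  have hAC' : Tendsto (fun j => A j - C' j) atTop (𝓝 0) :=
    tendsto_zero_of_averageForm_self hk (squeeze_zero (fun j => averageForm_self_nonneg hk _)
      (fun j => ((hC' j).2 _ (hC j).1).trans (hlt j).le) tendsto_one_div_add_atTop_nhds_zero_nat)
  have hDlim : Tendsto D atTop (𝓝 0) := by
    obtain ⟨c, hc, hcle⟩ := exists_norm_le_of_positions hh hk
    have h1 : Tendsto (fun j => c * ‖(A j - C j) - (A j - C' j)‖) atTop (𝓝 0) := by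
      simpa using (hAC.sub hAC').norm.const_mul c
    rw [tendsto_zero_iff_norm_tendsto_zero]
    refine squeeze_zero (fun j => norm_nonneg _) (fun j => ?_) h1
    refine ContinuousLinearMap.opNorm_le_bound _ (by positivity) fun y => ?_
    have h2 : (C j) (D j y) = ((A j - C j) - (A j - C' j)) y := by
      simp [hD, hCg]
    calc ‖D j y‖ ≤ c * ‖C j (D j y)‖ := hcle _ (hC j).1.1 _
      _ ≤ c * (‖(A j - C j) - (A j - C' j)‖ * ‖y‖) := by
        rw [h2]; gcongr; exact ContinuousLinearMap.le_opNorm _ _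
      _ = _ := by ring
  have hglim : Tendsto g atTop (𝓝 (ContinuousLinearMap.id ℝ Y)) := by
    simpa [hD] using hDlim.add_const (ContinuousLinearMap.id ℝ Y)
  obtain ⟨⟨C0, κ⟩, ⟨hC0, hκ⟩, φ, hφ, hφlim⟩ := ((isCompact_positions hh hk).prod
    (isCompact_sphere (0 : Y →L[ℝ] Y) 1)).tendsto_subseq
    (x := fun j => (C j, ‖D j‖⁻¹ • D j)) fun j => ⟨(hC j).1.1, by
      simp [norm_smul, (hDpos j).ne']⟩
  have hClim : Tendsto (fun j => C (φ j)) atTop (𝓝 C0) :=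
    (continuous_fst.tendsto _).comp hφlim
  have hκlim : Tendsto (fun j => ‖D (φ j)‖⁻¹ • D (φ j)) atTop (𝓝 κ) :=
    (continuous_snd.tendsto _).comp hφlim
  have hAlim : Tendsto (fun j => A (φ j)) atTop (𝓝 C0) := by
    simpa using (hAC.comp hφ.tendsto_atTop).add hClim
  have hgφ := hglim.comp hφ.tendsto_atTop
  -- The difference of the first-order conditions at `C` and `C'`, divided by `‖D‖`.
  have hzero : ∀ j, averageForm E hk (A (φ j))
      ((C (φ j)).comp ((‖D (φ j)‖⁻¹ • D (φ j)).comp κ)) = 0 := by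
    intro j
    have h1 := averageForm_comp_eq_zero_of_isMax hk (fun j => hg (φ j)) (fun j => hg1 (φ j)) hgφ
      hκlim (hC (φ j)).averageForm_comp_le
    have h2 := averageForm_comp_eq_zero_of_isMax hk (fun j => hg (φ j)) (fun j => hg1 (φ j)) hgφ
      hκlim (hC' (φ j)).averageForm_comp_le
    have h3 : (C (φ j)).comp ((‖D (φ j)‖⁻¹ • D (φ j)).comp κ) =
        ‖D (φ j)‖⁻¹ • ((C' (φ j)).comp κ - (C (φ j)).comp κ) := by
      ext y
      simp [hD, hCg]
    rw [h3, map_smul, map_sub, h1, h2]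
    simp
  have hlim0 : averageForm E hk C0 (C0.comp (κ.comp κ)) = 0 := by
    have h1 : Continuous fun p : (Y →L[ℝ] E) × (Y →L[ℝ] E) × (Y →L[ℝ] Y) =>
      averageForm E hk p.1 (p.2.1.comp (p.2.2.comp κ)) := by fun_prop
    have h2 := (h1.tendsto (C0, C0, κ)).comp (hAlim.prodMk_nhds (hClim.prodMk_nhds hκlim))
    exact tendsto_nhds_unique h2 (tendsto_const_nhds.congr fun j => (hzero j).symm)
  -- By skewness the vanishing term is minus the squared length of `C0.comp κ`.
  have hskew := averageForm_comp_add_comp_eq_zero hk (fun j => hg (φ j)) hgφ hκlim C0 (C0.comp κ)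
  rw [show (C0.comp κ).comp κ = C0.comp (κ.comp κ) from rfl, hlim0, add_zero] at hskew
  have hCκ : C0.comp κ = 0 := by
    by_contra h0
    exact (averageForm_self_pos hk h0).ne' hskew
  have hκ0 : κ = 0 := by
    ext y
    refine injective_of_mem_positions hh hk hC0 ?_
    simpa using congrArg (fun f => f y) hCκ
  rw [hκ0] at hκ
  simp at hκ

theorem exists_isNearest (hh : SupportLike h) (hk : SupportLike k) {u : E}
    (hne : (positionsAt h k u).Nonempty) (A : Y →L[ℝ] E) : ∃ C, IsNearest h hk u A C := by
  have hc : IsCompact (positionsAt h k u) := by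
    refine (isCompact_positions hh hk).of_isClosed_subset ?_ fun L hL => hL.1
    exact (isClosed_positionsAt_prod (k := k) hh).preimage (Continuous.prodMk_right u)
  obtain ⟨C, hC, hmin⟩ := hc.exists_isMinOn hne
    (f := fun C => averageForm E hk (A - C) (A - C)) (by fun_prop)
  exact ⟨C, hC, fun C' hC' => hmin hC'⟩

/-- In a sequence of counterexamples, `A` and arbitrary positions `B` over `u'` subconverge to
positions in one hyperplane, which differ by a symmetry `g`. Then `B.comp g` is a position over `u'`
close to `A`. -/
theorem exists_isNearest_lt (hh : SupportLike h) (hk : SupportLike k)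
    (hdim : Module.finrank ℝ E = Module.finrank ℝ Y + 1)
    (hne : ∀ u : E, u ≠ 0 → (positionsAt h k u).Nonempty) {K : Set E} (hK : IsCompact K)
    (hK0 : ∀ u ∈ K, u ≠ 0) {ε : ℝ} (hε : 0 < ε) :
    ∃ δ > 0, ∀ u ∈ K, ∀ u' ∈ K, ‖u - u'‖ < δ → ∀ A ∈ positionsAt h k u, ∀ C,
      IsNearest h hk u' A C → averageForm E hk (A - C) (A - C) < ε := by
  by_contra hcon
  push Not at hcon
  choose u hu u' hu' huu' A hA C hC hle using fun j : ℕ =>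
    hcon (1 / ((j : ℝ) + 1)) Nat.one_div_pos_of_nat
  choose B hB using fun j => hne (u' j) (hK0 _ (hu' j))
  obtain ⟨⟨u0, A0, B0⟩, ⟨hu0, hA0, hB0⟩, φ, hφ, hφlim⟩ := (hK.prod
    ((isCompact_positions hh hk).prod (isCompact_positions hh hk))).tendsto_subseq
    (x := fun j => (u j, A j, B j)) fun j => ⟨hu j, (hA j).1, (hB j).1⟩
  have hulim : Tendsto (fun j => u (φ j)) atTop (𝓝 u0) := (continuous_fst.tendsto _).comp hφlim
  have hAlim : Tendsto (fun j => A (φ j)) atTop (𝓝 A0) :=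
    ((continuous_fst.comp continuous_snd).tendsto _).comp hφlim
  have hBlim : Tendsto (fun j => B (φ j)) atTop (𝓝 B0) :=
    ((continuous_snd.comp continuous_snd).tendsto _).comp hφlim
  have hdiff : Tendsto (fun j => u j - u' j) atTop (𝓝 0) :=
    squeeze_zero_norm (fun j => (huu' j).le) tendsto_one_div_add_atTop_nhds_zero_nat
  have hulim' : Tendsto (fun j => u' (φ j)) atTop (𝓝 u0) := by
    simpa using hulim.sub (hdiff.comp hφ.tendsto_atTop)
  obtain ⟨g, hg, rfl⟩ := exists_comp_eq_of_mem_positionsAt hh hk hdim (hK0 _ hu0)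
    (mem_positionsAt_of_tendsto hh hulim' hBlim fun j => hB _)
    (mem_positionsAt_of_tendsto hh hulim hAlim fun j => hA _)
  have hc : Continuous fun p : (Y →L[ℝ] E) × (Y →L[ℝ] E) =>
    averageForm E hk (p.1 - p.2.comp g) (p.1 - p.2.comp g) := by fun_prop
  have hlim := (hc.tendsto (B0.comp g, B0)).comp (hAlim.prodMk_nhds hBlim)
  simp only [sub_self, map_zero] at hlim
  have h0 : ε ≤ 0 := by
    refine ge_of_tendsto hlim (Eventually.of_forall fun j => ?_)
    exact (hle (φ j)).trans ((hC (φ j)).2 _ (comp_mem_positionsAt (hB _) hg))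
  linarith

/-- By compactness it suffices that each limit point `C0` is again nearest to `A x0`; uniqueness
then identifies it with `C x0`. -/
theorem continuous_of_isNearest (hh : SupportLike h) (hk : SupportLike k)
    (hdim : Module.finrank ℝ E = Module.finrank ℝ Y + 1)
    (hne : ∀ u : E, u ≠ 0 → (positionsAt h k u).Nonempty) {K : Set E} (hK : IsCompact K)
    (hK0 : ∀ u ∈ K, u ≠ 0) {η : ℝ}
    (hη : ∀ u : E, u ≠ 0 → ∀ A C C' : Y →L[ℝ] E, IsNearest h hk u A C → IsNearest h hk u A C' →
      averageForm E hk (A - C) (A - C) < η → C = C')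
    {X : Type*} [MetricSpace X] {u : X → E} (hu : Continuous u) (huK : ∀ x, u x ∈ K)
    {A C : X → Y →L[ℝ] E} (hA : Continuous A)
    (hC : ∀ x, IsNearest h hk (u x) (A x) (C x))
    (hlt : ∀ x, averageForm E hk (A x - C x) (A x - C x) < η) : Continuous C := by
  refine continuous_iff_seqContinuous.2 fun x x0 hx => ?_
  refine tendsto_of_subseq_tendsto fun ns hns => ?_
  have hx' := hx.comp hns
  obtain ⟨C0, hC0, φ, hφ, hφlim⟩ := (isCompact_positions hh hk).tendsto_subseq
    (x := fun j => C (x (ns j))) fun j => (hC _).1.1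
  have hx'' := hx'.comp hφ.tendsto_atTop
  have hulim := (hu.tendsto x0).comp hx''
  refine ⟨φ, ?_⟩
  suffices h0 : C0 = C x0 from h0 ▸ hφlim
  symm
  refine hη (u x0) (hK0 _ (huK x0)) (A x0) (C x0) C0 (hC x0) ⟨?_, fun C' hC' => ?_⟩ (hlt x0)
  · exact mem_positionsAt_of_tendsto hh hulim hφlim fun j => (hC _).1
  -- To compare `C0` with a competitor `C'` over the limit hyperplane, approximate `C'` by positions
  -- over the nearby ones.
  choose B hB using fun j => exists_isNearest hh hk (hne _ (hK0 _ (huK (x (ns (φ j)))))) C'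
  have hBlim : Tendsto B atTop (𝓝 C') := by
    have h1 : Tendsto (fun j => averageForm E hk (C' - B j) (C' - B j)) atTop (𝓝 0) := by
      rw [Metric.tendsto_nhds]
      intro ε hε
      obtain ⟨δ, hδ, hδ'⟩ := exists_isNearest_lt hh hk hdim hne hK hK0 hε
      filter_upwards [(Metric.tendsto_nhds.1 hulim) δ hδ] with j hj
      rw [Real.dist_0_eq_abs, abs_of_nonneg (averageForm_self_nonneg hk _)]
      refine hδ' _ (huK x0) _ (huK _) ?_ _ hC' _ (hB j)
      rw [← dist_eq_norm, dist_comm]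
      exact hj
    have h2 := tendsto_zero_of_averageForm_self hk h1
    simpa using h2.const_sub C'
  have hAlim := (hA.tendsto x0).comp hx''
  have hc : Continuous fun p : (Y →L[ℝ] E) × (Y →L[ℝ] E) =>
    averageForm E hk (p.1 - p.2) (p.1 - p.2) := by fun_prop
  exact le_of_tendsto_of_tendsto' ((hc.tendsto (A x0, C0)).comp (hAlim.prodMk_nhds hφlim))
    ((hc.tendsto (A x0, C')).comp (hAlim.prodMk_nhds hBlim)) fun j => (hC _).2 _ (hB j).1

/-- Positions can be chosen continuously along a family of segments from a common point. -/
theorem exists_continuous_positionsAt (hh : SupportLike h) (hk : SupportLike k)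
    (hdim : Module.finrank ℝ E = Module.finrank ℝ Y + 1)
    (hne : ∀ u : E, u ≠ 0 → (positionsAt h k u).Nonempty)
    {X : Type*} [MetricSpace X] [CompactSpace X] {q : X → E} (hq : Continuous q) (p : E)
    (hp : ∀ x, ∀ t ∈ Set.Icc (0 : ℝ) 1, (1 - t) • p + t • q x ≠ 0) :
    ∃ L : X → Y →L[ℝ] E, Continuous L ∧ ∀ x, L x ∈ positionsAt h k (q x) := by
  rcases isEmpty_or_nonempty X with hX | hX
  · exact ⟨fun _ => 0, continuous_const, fun x => hX.elim x⟩
  let F : X × ℝ → E := fun z => (1 - z.2) • p + z.2 • q z.1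
  have hF : Continuous F := by fun_prop
  set K : Set E := F '' (Set.univ ×ˢ Set.Icc (0 : ℝ) 1)
  have hK : IsCompact K := (isCompact_univ.prod isCompact_Icc).image hF
  have hK0 : ∀ u ∈ K, u ≠ 0 := by
    rintro _ ⟨z, hz, rfl⟩
    exact hp z.1 z.2 hz.2
  obtain ⟨η, hη0, hη⟩ := exists_forall_isNearest_eq hh hk hdim
  obtain ⟨δ, hδ, hδ'⟩ := exists_isNearest_lt hh hk hdim hne hK hK0 hη0
  obtain ⟨M, hM⟩ := (isCompact_range (show Continuous fun x => q x - p by fun_prop)).isBounded.exists_norm_le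
  obtain ⟨m, hm⟩ := exists_nat_gt (M / δ)
  have hM0 : 0 ≤ M := (norm_nonneg _).trans (hM _ ⟨hX.some, rfl⟩)
  have hm0 : (0 : ℝ) < m := lt_of_le_of_lt (by positivity) hm
  have hIcc : ∀ j : ℕ, j ≤ m → ((j : ℝ) / m) ∈ Set.Icc (0 : ℝ) 1 := fun j hj =>
    ⟨by positivity, div_le_one_of_le₀ (by exact_mod_cast hj) hm0.le⟩
  have hFK : ∀ x, ∀ j : ℕ, j ≤ m → F (x, (j : ℝ) / m) ∈ K := fun x j hj =>
    ⟨_, ⟨Set.mem_univ _, hIcc j hj⟩, rfl⟩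
  -- Start from a constant position at `p` and advance along all segments at once; each step moves
  -- by less than `δ`, so passing to the nearest position keeps continuity.
  have key : ∀ j : ℕ, j ≤ m → ∃ L : X → Y →L[ℝ] E, Continuous L ∧
      ∀ x, L x ∈ positionsAt h k (F (x, (j : ℝ) / m)) := by
    intro j
    induction j with
    | zero =>
      intro _
      obtain ⟨L0, hL0⟩ := hne p (by simpa using hp hX.some 0 (by simp))
      exact ⟨fun _ => L0, continuous_const, fun x => by simpa [F] using hL0⟩
    | succ j ih =>
      intro hj
      obtain ⟨L, hL, hLmem⟩ := ih (by omega)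
      choose C hC using fun x => exists_isNearest hh hk (hne _ (hK0 _ (hFK x (j + 1) hj))) (L x)
      refine ⟨C, ?_, fun x => (hC x).1⟩
      refine continuous_of_isNearest hh hk hdim hne hK hK0 hη
        (u := fun x => F (x, ((j + 1 : ℕ) : ℝ) / m)) (by fun_prop) (fun x => hFK x _ hj) hL hC
        fun x => ?_
      refine hδ' _ (hFK x j (by omega)) _ (hFK x _ hj) ?_ _ (hLmem x) _ (hC x)
      have h1 : F (x, (j : ℝ) / m) - F (x, ((j + 1 : ℕ) : ℝ) / m) = -((1 / m : ℝ) • (q x - p)) := by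
        simp only [F]
        push_cast
        module
      rw [h1, norm_neg, norm_smul, Real.norm_of_nonneg (by positivity)]
      calc (1 / m : ℝ) * ‖q x - p‖ ≤ 1 / m * M := by gcongr; exact hM _ ⟨x, rfl⟩
        _ < δ := by
          rw [one_div, inv_mul_lt_iff₀ hm0]
          rwa [div_lt_iff₀ hδ] at hm
  obtain ⟨L, hL, hLmem⟩ := key m le_rfl
  refine ⟨L, hL, fun x => ?_⟩
  have h1 := hLmem x
  simp only [F, div_self hm0.ne'] at h1
  simpa using h1

end Lift

/-! ### Reversing vectors by symmetries; linearity of the odd part -/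

section Reversal

open MeasureTheory

variable {n : ℕ}

/-- Pushes the points of the `ℓ¹` sphere that are close to the equator onto the equator, and folds
the lower hemisphere onto the upper one vertically. -/
noncomputable def equatorPush (u : EuclideanSpace ℝ (Fin (n + 1))) :
    EuclideanSpace ℝ (Fin (n + 1)) :=
  u + (max (|u 0| - 1 / 2) 0 - u 0) • EuclideanSpace.single 0 1

/-- A cutoff that is `1` on the upper hemisphere and `0` far below the equator. -/
noncomputable def upperCutoff (u : EuclideanSpace ℝ (Fin (n + 1))) : ℝ :=
  min 1 (max 0 (1 + 2 * u 0))

theorem equatorPush_apply_zero (u : EuclideanSpace ℝ (Fin (n + 1))) :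
    equatorPush u 0 = max (|u 0| - 1 / 2) 0 := by
  simp [equatorPush]

theorem equatorPush_apply_of_ne (u : EuclideanSpace ℝ (Fin (n + 1))) {i : Fin (n + 1)}
    (hi : i ≠ 0) : equatorPush u i = u i := by
  simp [equatorPush, hi]

theorem equatorPush_ne_zero {u : EuclideanSpace ℝ (Fin (n + 1))} (hu : u ∈ l1Sphere n) :
    equatorPush u ≠ 0 := by
  intro h0
  have h1 : |u 0| ≤ 1 / 2 := by
    have h2 := equatorPush_apply_zero u
    rw [h0, PiLp.zero_apply] at h2
    linarith [le_max_left (|u 0| - 1 / 2) 0]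
  have h2 : ∀ i, i ≠ 0 → |u i| = 0 := fun i hi => by
    rw [← equatorPush_apply_of_ne u hi, h0, PiLp.zero_apply, abs_zero]
  have h3 : ∑ i, |u i| = 1 := hu
  rw [Finset.sum_eq_single 0 (fun i _ hi => h2 i hi) (by simp)] at h3
  linarith

theorem continuous_equatorPush : Continuous (equatorPush (n := n)) := by
  unfold equatorPush
  fun_prop

theorem equatorPush_neg {u : EuclideanSpace ℝ (Fin (n + 1))} (hu : |u 0| ≤ 1 / 2) :
    equatorPush (-u) = -equatorPush u := by
  have h : max (|u 0| - 1 / 2) 0 = 0 := max_eq_right (by linarith)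
  simp only [equatorPush, PiLp.neg_apply, abs_neg, h]
  module

/-- For `|u 0| ≤ 1 / 2` the push deletes the coordinate `0`, and the product is its squared length.
For `u 0 > 1 / 2` it is `‖u‖ ^ 2 - u 0 / 2`. -/
theorem inner_equatorPush_pos {u : EuclideanSpace ℝ (Fin (n + 1))} (hu : u ∈ l1Sphere n)
    (h0 : -(1 / 2) ≤ u 0) : 0 < inner ℝ (equatorPush u) u := by
  have hsq : u 0 ^ 2 ≤ ‖u‖ ^ 2 := by
    have := PiLp.norm_apply_le u 0
    rw [Real.norm_eq_abs] at this
    rw [← sq_abs (u 0)]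
    gcongr
  rcases le_or_gt (u 0) (1 / 2) with h | h
  · have h1 : max (|u 0| - 1 / 2) 0 = 0 := max_eq_right (by linarith [abs_le.2 ⟨h0, h⟩])
    have h2 : equatorPush u 0 = 0 := by rw [equatorPush_apply_zero, h1]
    have h3 : inner ℝ (equatorPush u) u = inner ℝ (equatorPush u) (equatorPush u) := by
      conv_rhs => rw [equatorPush, inner_add_right]
      rw [← equatorPush, real_inner_smul_right, EuclideanSpace.inner_single_right, h2]
      simp
    rw [h3]
    exact real_inner_self_pos.2 (equatorPush_ne_zero hu)
  · have h1 : max (|u 0| - 1 / 2) 0 = u 0 - 1 / 2 := by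
      rw [abs_of_pos (by linarith), max_eq_left (by linarith)]
    rw [equatorPush, h1, inner_add_left, real_inner_smul_left, EuclideanSpace.inner_single_left,
      real_inner_self_eq_norm_sq]
    simp
    nlinarith

variable {Y : Type*} [NormedAddCommGroup Y] [InnerProductSpace ℝ Y] [FiniteDimensional ℝ Y]
  [MeasurableSpace Y] [BorelSpace Y] {h : EuclideanSpace ℝ (Fin (n + 1)) → ℝ} {k : Y → ℝ}

/-- If `k` can be placed in every hyperplane, then every vector is reversed by a symmetry of
`k`. -/
theorem exists_positions_apply_eq_neg (hh : SupportLike h) (hk : SupportLike k)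
    (hdim : Module.finrank ℝ Y = n)
    (hne : ∀ u : EuclideanSpace ℝ (Fin (n + 1)), u ≠ 0 → (positionsAt h k u).Nonempty)
    {e : Y} (he : e ≠ 0) : ∃ g ∈ positions k k, g e = -e := by
  have hdim' : Module.finrank ℝ (EuclideanSpace ℝ (Fin (n + 1))) = Module.finrank ℝ Y + 1 := by
    simp [hdim]
  have : CompactSpace (l1Sphere n) := isCompact_iff_compactSpace.1 (isCompact_l1Sphere n)
  obtain ⟨L, hL, hLmem⟩ := exists_continuous_positionsAt hh hk hdim' hne
    (q := fun x : l1Sphere n => equatorPush (x : EuclideanSpace ℝ (Fin (n + 1))))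
    (continuous_equatorPush.comp continuous_subtype_val) (EuclideanSpace.single 0 1) (by
      intro x t ht h0
      -- The coordinate `0` on the segment is at least `1 - t`, so the segment could vanish only at
      -- its end, which is nonzero.
      have h1 := congrArg (fun z : EuclideanSpace ℝ (Fin (n + 1)) => z 0) h0
      simp only [PiLp.add_apply, PiLp.smul_apply, equatorPush_apply_zero, PiLp.zero_apply,
        smul_eq_mul, PiLp.single_apply, if_true, mul_one] at h1
      have h2 : 0 ≤ t * max (|(x : EuclideanSpace ℝ (Fin (n + 1))) 0| - 1 / 2) 0 :=
        mul_nonneg ht.1 (le_max_right _ _)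
      have h3 : t = 1 := le_antisymm ht.2 (by linarith)
      rw [h3] at h0
      exact equatorPush_ne_zero x.2 (by simpa using h0))
  classical
  let a : EuclideanSpace ℝ (Fin (n + 1)) → EuclideanSpace ℝ (Fin (n + 1)) :=
    fun u => if hu : u ∈ l1Sphere n then L ⟨u, hu⟩ e else 0
  have haL : ∀ u (hu : u ∈ l1Sphere n), a u = L ⟨u, hu⟩ e := fun u hu => dif_pos hu
  have hac : ContinuousOn a (l1Sphere n) := by
    rw [continuousOn_iff_continuous_domRestrict]
    have : (l1Sphere n).domRestrict a = fun x => L x e := funext fun x => haL x x.2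
    rw [this]
    exact hL.clm_apply continuous_const
  have ha0 : ∀ u ∈ l1Sphere n, a u ≠ 0 := fun u hu h0 => he <| by
    rw [haL u hu] at h0
    exact injective_of_mem_positions hh hk (hLmem ⟨u, hu⟩).1 (h0.trans (map_zero _).symm)
  have hinner : ∀ u ∈ l1Sphere n, inner ℝ (equatorPush u) (a u) = 0 := fun u hu => by
    rw [haL u hu]
    exact (hLmem ⟨u, hu⟩).2 e
  let b : EuclideanSpace ℝ (Fin (n + 1)) → EuclideanSpace ℝ (Fin (n + 1)) :=
    fun u => upperCutoff u • a u + upperCutoff (-u) • a (-u)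
  have hcut : Continuous (upperCutoff (n := n)) := by
    unfold upperCutoff
    fun_prop
  have hbc : ContinuousOn b (l1Sphere n) :=
    (hcut.continuousOn.smul hac).add ((hcut.comp continuous_neg).continuousOn.smul
      (hac.comp continuousOn_neg fun u hu => neg_mem_l1Sphere hu))
  have hbeven : ∀ u, b (-u) = b u := fun u => by
    simp only [b, neg_neg]
    exact add_comm _ _
  have hone : ∀ u : EuclideanSpace ℝ (Fin (n + 1)), 1 / 2 < u 0 → b u = a u := fun u hu => by
    have h1 : upperCutoff u = 1 := by
      rw [upperCutoff, max_eq_right (by linarith), min_eq_left (by linarith)]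
    have h2 : upperCutoff (-u) = 0 := by
      rw [upperCutoff, PiLp.neg_apply, max_eq_left (by linarith), min_eq_right (by linarith)]
    simp [b, h1, h2]
  have hbinner : ∀ u ∈ l1Sphere n, -(1 / 2) ≤ u 0 → inner ℝ (equatorPush u) (b u) = 0 := by
    intro u hu h0
    rcases le_or_gt (u 0) (1 / 2) with h1 | h1
    · have h2 := hinner _ (neg_mem_l1Sphere hu)
      rw [equatorPush_neg (abs_le.2 ⟨h0, h1⟩), inner_neg_left, neg_eq_zero] at h2
      simp only [b, inner_add_right, real_inner_smul_right, hinner u hu, h2]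
      simp
    · rw [hone u h1]
      exact hinner u hu
  obtain ⟨x, hx, t, ht, hxt⟩ := exists_segment_eq_zero_of_even hbc fun u _ => hbeven u
  -- Since `b` is even, `x` may be replaced by `-x` to lie above `-(1 / 2)`. There `b x` is
  -- orthogonal to the push while `x` is not, so the segment can vanish only at `t = 1`.
  have hb0 : b x = 0 := by
    have ht1 : 1 - t = 0 := by
      rcases le_or_gt (-(1 / 2)) (x 0) with h0 | h0
      · have h1 := congrArg (fun z => inner ℝ (equatorPush x) z) hxt
        simp only [inner_add_right, real_inner_smul_right, hbinner x hx h0, inner_zero_right,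
          mul_zero, add_zero] at h1
        exact (mul_eq_zero.1 h1).resolve_right (inner_equatorPush_pos hx h0).ne'
      · have hx' := neg_mem_l1Sphere hx
        have h0' : -(1 / 2) ≤ (-x) 0 := by rw [PiLp.neg_apply]; linarith
        have h1 := congrArg (fun z => inner ℝ (equatorPush (-x)) z) hxt
        have h2 := inner_equatorPush_pos hx' h0'
        have h3 := hbinner _ hx' h0'
        rw [hbeven] at h3
        rw [inner_neg_right] at h2
        simp only [inner_add_right, real_inner_smul_right, h3, inner_zero_right,
          mul_zero, add_zero] at h1
        exact (mul_eq_zero.1 h1).resolve_right (by linarith)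
    have h1 : t = 1 := by linarith
    rw [h1] at hxt
    simpa using hxt
  have hx0 : |x 0| ≤ 1 / 2 := by
    rw [abs_le]
    constructor
    · by_contra hlt
      push Not at hlt
      have h1 := hone (-x) (by rw [PiLp.neg_apply]; linarith)
      rw [hbeven, hb0] at h1
      exact ha0 _ (neg_mem_l1Sphere hx) h1.symm
    · by_contra hlt
      push Not at hlt
      have h1 := hone x hlt
      rw [hb0] at h1
      exact ha0 _ hx h1.symm
  -- In the band `|x 0| ≤ 1 / 2` the pushes of `x` and `-x` are opposite, hence define the same
  -- hyperplane.
  have hmem' : L ⟨-x, neg_mem_l1Sphere hx⟩ ∈ positionsAt h k (equatorPush x) := by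
    have h1 := hLmem ⟨-x, neg_mem_l1Sphere hx⟩
    simp only [equatorPush_neg hx0] at h1
    exact ⟨h1.1, fun y => by simpa using h1.2 y⟩
  obtain ⟨g, hg, hLg⟩ := exists_comp_eq_of_mem_positionsAt hh hk hdim' (equatorPush_ne_zero hx)
    (hLmem ⟨x, hx⟩) hmem'
  refine ⟨g, hg, ?_⟩
  have hsum : upperCutoff x • e + upperCutoff (-x) • g e = 0 := by
    refine injective_of_mem_positions hh hk (hLmem ⟨x, hx⟩).1 ?_
    have h1 : b x = upperCutoff x • L ⟨x, hx⟩ e + upperCutoff (-x) • L ⟨x, hx⟩ (g e) := by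
      simp only [b, haL x hx, haL (-x) (neg_mem_l1Sphere hx), hLg]
      rfl
    rw [map_add, map_smul, map_smul, ← h1, hb0, map_zero]
  have hα : ∀ u : EuclideanSpace ℝ (Fin (n + 1)), 0 ≤ upperCutoff u := fun u =>
    le_min zero_le_one (le_max_left _ _)
  -- `e` and `-(g e)` have the same positive width, so their coefficients agree.
  have heq : upperCutoff x = upperCutoff (-x) := by
    have h1 : upperCutoff x • e = upperCutoff (-x) • -(g e) := by
      rw [smul_neg]; exact eq_neg_of_add_eq_zero_left hsum
    have h2 := congrArg (width k) h1
    have h3 : width k (-(g e)) = width k e := by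
      rw [← width_apply_of_mem_positions hg e]
      simp only [width, neg_neg]
      ring
    rw [hk.width_smul (hα _), hk.width_smul (hα _), h3] at h2
    exact mul_right_cancel₀ (hk.width_pos e he).ne' h2
  have hpos : upperCutoff x ≠ 0 := by
    intro h0
    have h1 : ∀ u : EuclideanSpace ℝ (Fin (n + 1)), upperCutoff u = 0 → 1 + 2 * u 0 ≤ 0 := by
      intro u hu
      by_contra hlt
      push Not at hlt
      have : 0 < upperCutoff u := lt_min one_pos (lt_max_of_lt_right hlt)
      linarith
    have h2 := h1 x h0
    have h3 := h1 (-x) (heq ▸ h0)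
    rw [PiLp.neg_apply] at h3
    linarith
  rw [← heq, ← smul_add] at hsum
  exact (neg_eq_of_add_eq_zero_right ((smul_eq_zero.1 hsum).resolve_left hpos)).symm

/-- `ξ` is the `L²` projection of `f` to the linear functionals; it exists because the averaged form
on the dual is nondegenerate. -/
theorem exists_forall_setIntegral_mul_eq (hk : SupportLike k) {f : Y → ℝ} (hf : Continuous f) :
    ∃ ξ : Y →L[ℝ] ℝ, ∀ ℓ : Y →L[ℝ] ℝ, ∫ y in widthBody k, (f y - ξ y) * ℓ y = 0 := by
  let Φ : (Y →L[ℝ] ℝ) →ₗ[ℝ] ℝ :=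
    { toFun := fun ℓ => ∫ y in widthBody k, f y * ℓ y
      map_add' := fun ℓ ℓ' => by
        simp only [add_apply, mul_add]
        exact integral_add (integrableOn_widthBody hk (by fun_prop))
          (integrableOn_widthBody hk (by fun_prop))
      map_smul' := fun c ℓ => by
        simp only [smul_apply, smul_eq_mul, mul_left_comm _ c, RingHom.id_apply]
        exact integral_const_mul _ _ }
  let β : (Y →L[ℝ] ℝ) →ₗ[ℝ] Module.Dual ℝ (Y →L[ℝ] ℝ) :=
    { toFun := fun A => (averageForm ℝ hk A).toLinearMap
      map_add' := fun A A' => by ext; simp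
      map_smul' := fun c A => by ext; simp }
  have hβ : Function.Injective β := by
    refine (injective_iff_map_eq_zero β).2 fun A hA => ?_
    by_contra h0
    have := averageForm_self_pos hk h0
    rw [show averageForm ℝ hk A A = β A A from rfl, hA] at this
    simp at this
  obtain ⟨ξ, hξ⟩ := (LinearMap.injective_iff_surjective_of_finrank_eq_finrank
    Subspace.dual_finrank_eq.symm).1 hβ Φ
  refine ⟨ξ, fun ℓ => ?_⟩
  have h1 : ∫ y in widthBody k, inner ℝ (ξ y) (ℓ y) = ∫ y in widthBody k, f y * ℓ y :=
    congrArg (fun φ => φ ℓ) hξ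
  simp only [sub_mul]
  rw [integral_sub (integrableOn_widthBody hk (by fun_prop))
    (integrableOn_widthBody hk (by fun_prop)), ← h1, sub_eq_zero]
  simp [mul_comm]

/-- If `k` can be placed in every hyperplane, then its odd part is linear. -/
theorem exists_linear_eq_odd_part (hh : SupportLike h) (hk : SupportLike k)
    (hdim : Module.finrank ℝ Y = n)
    (hne : ∀ u : EuclideanSpace ℝ (Fin (n + 1)), u ≠ 0 → (positionsAt h k u).Nonempty) :
    ∃ ℓ : Y →ₗ[ℝ] ℝ, ∀ y, k y - k (-y) = ℓ y := by
  have hkc := hk.continuous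
  have hf : Continuous fun y => k y - k (-y) := by fun_prop
  obtain ⟨ξ, hξ⟩ := exists_forall_setIntegral_mul_eq hk hf
  set f : Y → ℝ := fun y => k y - k (-y) - ξ y with hfdef
  have hfc : Continuous f := by fun_prop
  refine ⟨ξ.toLinearMap, fun e => ?_⟩
  rcases eq_or_ne e 0 with rfl | he
  · simp
  obtain ⟨g, hg, hge⟩ := exists_positions_apply_eq_neg hh hk hdim hne he
  obtain ⟨g', hg', hgg', hg'g⟩ := exists_inverse_of_mem_positions hk hg
  obtain ⟨ℓ, hℓ⟩ := hg
  have hg : g ∈ positions k k := ⟨ℓ, hℓ⟩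
  let m : Y →L[ℝ] ℝ := LinearMap.toContinuousLinearMap
    ((2 : ℝ) • ℓ - ξ.toLinearMap.comp g.toLinearMap + ξ.toLinearMap)
  have hm : ∀ y, f (g y) = f y + m y := by
    intro y
    simp only [hfdef, ← map_neg g, hℓ, m]
    simp
    ring
  -- Both `f` and `f ∘ g` are orthogonal to all linear functionals, the latter by invariance of the
  -- integral, so their linear difference `m` is orthogonal to itself.
  have hzero : averageForm ℝ hk m m = 0 := by
    have h1 := setIntegral_widthBody_comp hk hg fun y => f y * m (g' y)
    have h2 := hξ (m.comp g')
    simp only [ContinuousLinearMap.comp_apply] at h2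
    rw [h2] at h1
    have h3 : ∀ y, g' (g y) = y := fun y => congrArg (fun φ => φ y) hg'g
    simp only [h3, hm, add_mul] at h1
    rw [integral_add (integrableOn_widthBody hk (by fun_prop))
      (integrableOn_widthBody hk (by fun_prop)), hξ m, zero_add] at h1
    rw [averageForm_apply, ← h1]
    simp [← pow_two]
  have hm0 : m = 0 := by
    by_contra h0
    exact (averageForm_self_pos hk h0).ne' hzero
  have h1 := hm e
  rw [hm0, hge] at h1
  simp only [hfdef, neg_neg, map_neg, zero_apply, add_zero] at h1
  simp only [ContinuousLinearMap.coe_coe]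
  linarith

end Reversal

/-! ### Support functions of convex bodies -/

section SupportFunction

variable {V W : Type*} [NormedAddCommGroup V] [InnerProductSpace ℝ V] [NormedAddCommGroup W]
  [InnerProductSpace ℝ W] {S : Set V}

/-- The support function of a set. -/
noncomputable def supportFun (S : Set V) (w : V) : ℝ := sSup ((fun x => inner ℝ w x) '' S)

theorem isLUB_supportFun (hS : IsCompact S) (hne : S.Nonempty) (w : V) :
    IsLUB ((fun x => inner ℝ w x) '' S) (supportFun S w) :=
  isLUB_csSup (hne.image _)
    (hS.image_of_continuousOn (by fun_prop)).bddAbove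

theorem inner_le_supportFun (hS : IsCompact S) {x : V} (hx : x ∈ S) (w : V) :
    inner ℝ w x ≤ supportFun S w :=
  (isLUB_supportFun hS ⟨x, hx⟩ w).1 ⟨x, hx, rfl⟩

theorem supportFun_le (hne : S.Nonempty) {w : V} {c : ℝ} (h : ∀ x ∈ S, inner ℝ w x ≤ c) :
    supportFun S w ≤ c :=
  csSup_le (hne.image _) (by rintro _ ⟨x, hx, rfl⟩; exact h x hx)

theorem mem_of_forall_inner_le_supportFun [CompleteSpace V] (hS : IsCompact S) (hne : S.Nonempty)
    (hc : Convex ℝ S)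
    {x : V} (hx : ∀ w, inner ℝ w x ≤ supportFun S w) : x ∈ S := by
  by_contra hxS
  obtain ⟨f, c, h1, h2⟩ := geometric_hahn_banach_closed_point hc hS.isClosed hxS
  have h3 : ∀ y, inner ℝ ((InnerProductSpace.toDual ℝ V).symm f) y = f y := fun y =>
    InnerProductSpace.toDual_symm_apply
  have h4 := hx ((InnerProductSpace.toDual ℝ V).symm f)
  rw [h3] at h4
  have h5 := supportFun_le hne (w := (InnerProductSpace.toDual ℝ V).symm f) (c := c)
    fun y hy => by rw [h3]; exact (h1 y hy).le
  linarith

theorem supportLike_supportFun (hS : IsCompact S) (hint : (interior S).Nonempty) :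
    SupportLike (supportFun S) := by
  have hne : S.Nonempty := hint.mono interior_subset
  refine ⟨?_, fun c hc w => ?_, fun w hw => ?_⟩
  · obtain ⟨R, hR⟩ := hS.isBounded.exists_norm_le
    have hle : ∀ v w, supportFun S v ≤ supportFun S w + R * ‖v - w‖ := by
      intro v w
      refine supportFun_le hne fun x hx => ?_
      have h1 := inner_le_supportFun hS hx w
      have h2 : inner ℝ v x = inner ℝ w x + inner ℝ (v - w) x := by rw [inner_sub_left]; ring
      have h3 := real_inner_le_norm (v - w) x
      have h4 : ‖v - w‖ * ‖x‖ ≤ ‖v - w‖ * R := by gcongr; exact hR x hx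
      linarith
    have hR0 : 0 ≤ R := (norm_nonneg _).trans (hR _ hne.some_mem)
    refine (LipschitzWith.of_dist_le_mul (K := R.toNNReal) fun v w => ?_).continuous
    rw [Real.dist_eq, dist_eq_norm, Real.coe_toNNReal R hR0, abs_sub_le_iff]
    have h1 := hle v w
    have h2 := hle w v
    rw [norm_sub_rev] at h2
    constructor <;> linarith
  · have hle : ∀ c : ℝ, 0 ≤ c → ∀ w, supportFun S (c • w) ≤ c * supportFun S w := by
      intro c hc w
      refine supportFun_le hne fun x hx => ?_
      rw [real_inner_smul_left]
      exact mul_le_mul_of_nonneg_left (inner_le_supportFun hS hx w) hc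
    refine le_antisymm (hle c hc w) ?_
    rcases hc.eq_or_lt with rfl | hc'
    · rw [zero_smul, zero_mul]
      have := inner_le_supportFun hS hne.some_mem (0 : V)
      rwa [inner_zero_left] at this
    · have h1 := hle c⁻¹ (by positivity) (c • w)
      rw [inv_smul_smul₀ hc'.ne', inv_mul_eq_div, le_div_iff₀ hc'] at h1
      linarith
  · obtain ⟨x, hx⟩ := hint
    have hcont : Filter.Tendsto (fun t : ℝ => x + t • w) (nhdsWithin 0 (Set.Ioi 0)) (nhds x) := by
      have : Continuous fun t : ℝ => x + t • w := by fun_prop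
      simpa using (this.tendsto 0).mono_left nhdsWithin_le_nhds
    obtain ⟨t, ht, ht0⟩ := ((hcont.eventually (isOpen_interior.mem_nhds hx)).and
      self_mem_nhdsWithin).exists
    have h1 := inner_le_supportFun hS (interior_subset ht) w
    have h2 := inner_le_supportFun hS (interior_subset hx) (-w)
    rw [inner_add_right, real_inner_smul_right] at h1
    rw [inner_neg_left] at h2
    have h3 : 0 < t * inner ℝ w w := mul_pos ht0 (real_inner_self_pos.2 hw)
    linarith

theorem SupportLike.comp_linearIsometry {h : V → ℝ} (hh : SupportLike h) (J : W →ₗᵢ[ℝ] V) :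
    SupportLike fun w => h (J w) := by
  refine ⟨hh.continuous.comp J.continuous, fun c hc x => ?_, fun x hx => ?_⟩
  · rw [_root_.map_smul, hh.map_smul c hc]
  · rw [map_neg]
    exact hh.width_pos _ fun h0 => hx (J.injective (h0.trans (_root_.map_zero J).symm))

/-- An affine equivalence between two sets places the support function of the second inside that of
the first. -/
theorem exists_mem_positions_of_affinelyEquivalent [FiniteDimensional ℝ V] [FiniteDimensional ℝ W]
    {T : Set W} (hS : IsCompact S) (hne : S.Nonempty) (h : AffinelyEquivalent S T) :
    ∃ L : W →L[ℝ] V, L ∈ positions (supportFun S) (supportFun T) := by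
  obtain ⟨f, rfl⟩ := h
  let A : V →L[ℝ] W := LinearMap.toContinuousLinearMap f.linear.toLinearMap
  have hf : ∀ x, f x = A x + f 0 := fun x => by
    have h1 := f.map_vadd 0 x
    rwa [vadd_eq_add, vadd_eq_add, add_zero] at h1
  -- For `f x = A x + f 0`, the support function of the image at `w` is that of `S` at the adjoint
  -- image of `w`, plus `inner ℝ (f 0) w`.
  refine ⟨ContinuousLinearMap.adjoint A, -(innerSL ℝ (f 0)).toLinearMap, fun w => ?_⟩
  have hcont : Continuous f := by
    rw [show (f : V → W) = fun x => A x + f 0 from funext hf]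
    fun_prop
  have hin : ∀ x, inner ℝ w (f x) = inner ℝ (ContinuousLinearMap.adjoint A w) x +
      inner ℝ (f 0) w := fun x => by
    rw [hf x, inner_add_right, ContinuousLinearMap.adjoint_inner_left, real_inner_comm w (f 0)]
  apply le_antisymm
  · refine supportFun_le hne fun x hx => ?_
    have h1 := inner_le_supportFun (hS.image hcont) ⟨x, hx, rfl⟩ w
    rw [hin] at h1
    simp only [LinearMap.neg_apply, ContinuousLinearMap.coe_coe, innerSL_apply_apply]
    linarith
  · have h1 : supportFun (f '' S) w ≤ supportFun S (ContinuousLinearMap.adjoint A w) +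
        inner ℝ (f 0) w := by
      refine supportFun_le (hne.image f) ?_
      rintro _ ⟨x, hx, rfl⟩
      rw [hin]
      have := inner_le_supportFun hS hx (ContinuousLinearMap.adjoint A w)
      linarith
    simp only [LinearMap.neg_apply, ContinuousLinearMap.coe_coe, innerSL_apply_apply]
    linarith

theorem supportFun_orthProj {N : ℕ} (U : Submodule ℝ (EuclideanSpace ℝ (Fin N)))
    (S : Set (EuclideanSpace ℝ (Fin N))) (w : U) :
    supportFun (orthProj U S) w = supportFun S (w : EuclideanSpace ℝ (Fin N)) := by
  simp only [supportFun, orthProj, Set.image_image,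
    Submodule.inner_orthogonalProjectionOnto_eq_of_mem_left]

end SupportFunction

/-! ### From subspaces to the whole space -/

theorem Submodule.exists_le_and_finrank_eq {V : Type*} [AddCommGroup V] [Module ℝ V]
    [FiniteDimensional ℝ V] (W : Submodule ℝ V) {n : ℕ} (hW : Module.finrank ℝ W ≤ n)
    (hn : n ≤ Module.finrank ℝ V) : ∃ W' : Submodule ℝ V, W ≤ W' ∧ Module.finrank ℝ W' = n := by
  induction n, hW using Nat.le_induction with
  | base => exact ⟨W, le_rfl, rfl⟩
  | succ n _ ih =>
    obtain ⟨W', hWW', hW'⟩ := ih (by omega)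
    obtain ⟨v, hv⟩ := W'.exists_of_finrank_lt (by omega)
    have hv' : v ∉ W' := by simpa using hv 1 one_ne_zero
    refine ⟨W' ⊔ Submodule.span ℝ {v}, hWW'.trans le_sup_left, le_antisymm ?_ ?_⟩
    · have h1 := Submodule.finrank_add_le_finrank_add_finrank W' (Submodule.span ℝ {v})
      have h2 := finrank_span_finset_le_card (R := ℝ) {v}
      rw [Finset.coe_singleton, Finset.card_singleton, Set.finrank] at h2
      omega
    · have hlt : W' < W' ⊔ Submodule.span ℝ {v} := by
        refine lt_of_le_of_ne le_sup_left fun h => hv' ?_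
        rw [h]
        exact Submodule.mem_sup_right (Submodule.mem_span_singleton_self v)
      have := Submodule.finrank_lt_finrank_of_lt hlt
      omega

/-- A convex body whose support function has a linear odd part is centrally symmetric. -/
theorem centrallySymmetric_of_odd_part_linear {V : Type*} [NormedAddCommGroup V]
    [InnerProductSpace ℝ V] [FiniteDimensional ℝ V] {S : Set V} (hS : IsCompact S)
    (hne : S.Nonempty) (hc : Convex ℝ S) (ℓ : V →ₗ[ℝ] ℝ)
    (hℓ : ∀ w, supportFun S w - supportFun S (-w) = ℓ w) : CentrallySymmetric S := by
  set v : V := (InnerProductSpace.toDual ℝ V).symm (LinearMap.toContinuousLinearMap ℓ) with hv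
  have hvℓ : ∀ w, inner ℝ w v = ℓ w := fun w => by
    rw [real_inner_comm, hv, InnerProductSpace.toDual_symm_apply]
    rfl
  have href : ∀ x, AffineEquiv.pointReflection ℝ ((2⁻¹ : ℝ) • v) x = v - x := fun x => by
    rw [AffineEquiv.pointReflection_apply]
    simp only [vsub_eq_sub, vadd_eq_add]
    module
  -- The support function of `v - S` at `w` is `ℓ w + supportFun S (-w)`, which is that of `S`.
  have hmem : ∀ x ∈ S, v - x ∈ S := fun x hx => by
    refine mem_of_forall_inner_le_supportFun hS hne hc fun w => ?_
    have h1 := inner_le_supportFun hS hx (-w)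
    rw [inner_neg_left] at h1
    rw [inner_sub_right, hvℓ, ← hℓ]
    linarith
  refine ⟨(2⁻¹ : ℝ) • v, Set.Subset.antisymm ?_ fun x hx => ⟨v - x, hmem x hx, ?_⟩⟩
  · rintro _ ⟨x, hx, rfl⟩
    rw [href]
    exact hmem x hx
  · rw [href, sub_sub_cancel]

/-- If the projections onto `n`-dimensional subspaces are affinely equivalent, then the odd part of
the support function is linear on each of these subspaces. -/
theorem exists_linear_odd_part_on_submodule {n N : ℕ} (hnN : n < N)
    {S : Set (EuclideanSpace ℝ (Fin N))} (hS : IsCompact S) (hint : (interior S).Nonempty)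
    (h : ∀ U W : Submodule ℝ (EuclideanSpace ℝ (Fin N)),
      Module.finrank ℝ U = n → Module.finrank ℝ W = n →
        AffinelyEquivalent (orthProj U S) (orthProj W S))
    (W : Submodule ℝ (EuclideanSpace ℝ (Fin N))) (hW : Module.finrank ℝ W = n) :
    ∃ ℓ : W →ₗ[ℝ] ℝ, ∀ w : W, supportFun S w - supportFun S (-(w : EuclideanSpace ℝ (Fin N))) =
      ℓ w := by
  have hne : S.Nonempty := hint.mono interior_subset
  have hh := supportLike_supportFun hS hint
  obtain ⟨F, -, hF⟩ := Submodule.exists_le_and_finrank_eq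
    (⊥ : Submodule ℝ (EuclideanSpace ℝ (Fin N))) (n := n + 1) (by simp) (by simpa using hnN)
  -- Any `(n + 1)`-dimensional subspace will do, and it exists because `n < N`; `W` need not lie in
  -- it.
  let J : EuclideanSpace ℝ (Fin (n + 1)) →ₗᵢ[ℝ] EuclideanSpace ℝ (Fin N) :=
    F.subtypeₗᵢ.comp (((stdOrthonormalBasis ℝ F).reindex (finCongr hF)).repr.symm).toLinearIsometry
  refine exists_linear_eq_odd_part (n := n) (hh.comp_linearIsometry J)
    (hh.comp_linearIsometry W.subtypeₗᵢ) hW fun u hu => ?_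
  have : Fact (Module.finrank ℝ (EuclideanSpace ℝ (Fin (n + 1))) = n + 1) := ⟨by simp⟩
  let e := Submodule.equivMapOfInjective J.toLinearMap J.injective (ℝ ∙ u)ᗮ
  have he : ∀ z, ((e z : _) : EuclideanSpace ℝ (Fin N)) = J z := fun z => rfl
  have hU : Module.finrank ℝ ((ℝ ∙ u)ᗮ.map J.toLinearMap) = n := by
    rw [← e.finrank_eq, Submodule.finrank_orthogonal_span_singleton (n := n) hu]
  have hcomp : IsCompact (orthProj ((ℝ ∙ u)ᗮ.map J.toLinearMap) S) :=
    hS.image (ContinuousLinearMap.continuous _)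
  obtain ⟨T, ℓ, hℓ⟩ := exists_mem_positions_of_affinelyEquivalent hcomp (hne.image _) (h _ W hU hW)
  refine ⟨LinearMap.toContinuousLinearMap
    ((ℝ ∙ u)ᗮ.subtype.comp (e.symm.toLinearMap.comp T.toLinearMap)), ⟨ℓ, fun w => ?_⟩, fun w => ?_⟩
  · have h1 := hℓ w
    rw [supportFun_orthProj, supportFun_orthProj] at h1
    have h2 : J (e.symm (T w) : EuclideanSpace ℝ (Fin (n + 1))) = T w := by
      rw [← he, e.apply_symm_apply]
    change supportFun S (J (e.symm (T w) : EuclideanSpace ℝ (Fin (n + 1)))) = _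
    rw [h2]
    exact h1
  · exact Submodule.mem_orthogonal_singleton_iff_inner_right.1 (e.symm (T w)).2

theorem mainTheorem5 (n N : ℕ) (hn : 1 < n) (hnN : n < N)
    (B : ConvexBody (EuclideanSpace ℝ (Fin N)))
    (hBint : (interior (B : Set (EuclideanSpace ℝ (Fin N)))).Nonempty)
    (hB : ∀ U W : Submodule ℝ (EuclideanSpace ℝ (Fin N)),
      Module.finrank ℝ U = n → Module.finrank ℝ W = n →
        AffinelyEquivalent (orthProj U (B : Set (EuclideanSpace ℝ (Fin N))))
          (orthProj W (B : Set (EuclideanSpace ℝ (Fin N))))) :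
    CentrallySymmetric (B : Set (EuclideanSpace ℝ (Fin N))) := by
  have hlin := exists_linear_odd_part_on_submodule hnN B.isCompact hBint hB
  -- Additivity involves two vectors at a time, so `n ≥ 2` suffices to pass from subspaces to the
  -- whole space.
  have hplane : ∀ x y : EuclideanSpace ℝ (Fin N), ∃ W : Submodule ℝ (EuclideanSpace ℝ (Fin N)),
      Module.finrank ℝ W = n ∧ x ∈ W ∧ y ∈ W := by
    intro x y
    have hspan : Module.finrank ℝ (Submodule.span ℝ {x, y}) ≤ 2 := by
      classical
      have h1 := (finrank_span_finset_le_card (R := ℝ) {x, y}).trans Finset.card_le_two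
      rwa [Finset.coe_pair] at h1
    obtain ⟨W, hle, hW⟩ := Submodule.exists_le_and_finrank_eq (Submodule.span ℝ {x, y}) (n := n)
      (hspan.trans hn)
      (by simpa using hnN.le)
    exact ⟨W, hW, hle (Submodule.subset_span (by simp)), hle (Submodule.subset_span (by simp))⟩
  refine centrallySymmetric_of_odd_part_linear B.isCompact B.nonempty B.convex
    { toFun := fun w => supportFun B w - supportFun B (-w)
      map_add' := fun x y => ?_
      map_smul' := fun c x => ?_ } fun w => rfl
  · obtain ⟨W, hW, hx, hy⟩ := hplane x y
    obtain ⟨ℓ, hℓ⟩ := hlin W hW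
    have h1 := hℓ ⟨x, hx⟩
    have h2 := hℓ ⟨y, hy⟩
    have h3 := hℓ (⟨x, hx⟩ + ⟨y, hy⟩)
    rw [map_add, ← h1, ← h2] at h3
    exact h3
  · obtain ⟨W, hW, hx, -⟩ := hplane x x
    obtain ⟨ℓ, hℓ⟩ := hlin W hW
    have h1 := hℓ ⟨x, hx⟩
    have h3 := hℓ (c • ⟨x, hx⟩)
    rw [map_smul, ← h1] at h3
    exact h3
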